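/- There are numerical constants $C,\alpha,\beta>0$ such that the following holds. Let $1\le m<n$, let $\mathbb K\in\{\mathbb R,\mathbb C\}$, and let $$A=\frac1{\sqrt m}\begin{pmatrix}a_1^*\\ \vdots\\ a_m^*\end{pmatrix}\in\mathbb K^{m\times n},$$ where $a_1,\dots,a_m$ are $m$ iid copies of a random vector $a\in\mathbb K^n$ with $\mathbb E\,aa^*=I$ and $\|a\|_\infty\le\sqrt\mu$ almost surely. Let $x\in\mathbb R^n$ and $f\in\mathbb R^m$ be random vectors with fixed (deterministic) supports $T\subset\{1,\dots,n\}$ and $B\subset\{1,\dots,m\}$, such that the sign sequences $\mathrm{sgn}(x_T)$ and $\mathrm{sgn}(f_B)$ are each a sequence of iid symmetric $\pm1$ variables, are independent of each other, and the pair of them is independent of $(a_1,\dots,a_m)$; nothing is assumed about the magnitudes of the entries. If $$|T|\le\alpha\,\frac{m}{\mu\log^2 n}\qquad\text{and}\qquad |B|\le\beta\,\frac m\mu ,$$ then, with probability at least $1-Cn^{-3}$, the pair $(x,f)$ is the unique solution of $$\min_{\tilde x\in\mathbb K^n,\ \tilde f\in\mathbb K^m}\ \|\tilde x\|_1+\lambda\|\tilde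 f\|_1\quad\text{subject to}\quad A\tilde x+\tilde f=Ax+f,\qquad \lambda=\frac1{\sqrt{\log n}} .$$ -/

import Mathlib

open MeasureTheory ProbabilityTheory

/-- Properties of the distribution `ν` of the generic sensing vector `a`: it is a probability
measure on `𝕜ⁿ`, it is isotropic, `E (a a*) = I`, and `‖a‖_∞ ≤ √μ` almost surely. -/
structure IsSensingLaw {𝕜 : Type*} [RCLike 𝕜] {n : ℕ} (ν : Measure (Fin n → 𝕜)) (μ : ℝ) :
    Prop where
  isProbabilityMeasure : IsProbabilityMeasure ν
  isotropic : ∀ j k : Fin n, ∫ v, v j * star (v k) ∂ν = if j = k then 1 else 0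
  bounded : ∀ᵐ v ∂ν, ∀ j : Fin n, ‖v j‖ ≤ √μ

/-- The `m × n` sensing matrix `(1/√m) [a₁*; …; a_m*]`, whose rows are the conjugate transposes
of the vectors `a₁, …, a_m`, normalized by `1/√m`. -/
noncomputable def sensingMatrix {𝕜 : Type*} [RCLike 𝕜] {m n : ℕ} (a : Fin m → Fin n → 𝕜) :
    Matrix (Fin m) (Fin n) 𝕜 :=
  Matrix.of fun i j => ((1 / √(m : ℝ) : ℝ) : 𝕜) * star (a i j)

/-- The sequence of signs of the entries of the real vector `z` with indices in `T`. -/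
noncomputable def signsOn {ι : Type*} (T : Finset ι) (z : ι → ℝ) : T → ℝ :=
  fun i => Real.sign (z i)

/-- The real random vector `z` has the fixed support `T`, and its signs on `T` form a sequence of
independent symmetric `±1` variables. Nothing is assumed about the magnitudes. -/
structure HasRandomSigns {Ω ι : Type*} [MeasurableSpace Ω] (P : Measure Ω) (T : Finset ι)
    (z : Ω → ι → ℝ) : Prop where
  measurable : Measurable z
  support_eq : ∀ᵐ ω ∂P, Function.support (z ω) = (T : Set ι)
  indep : iIndepFun (fun (i : T) ω => signsOn T (z ω) i) P
  prob_pos : ∀ i : T, P {ω | signsOn T (z ω) i = 1} = 1 / 2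
  prob_neg : ∀ i : T, P {ω | signsOn T (z ω) i = -1} = 1 / 2

/-- The objective `‖x‖₁ + lam ‖f‖₁`. -/
noncomputable def l1Objective {𝕜 : Type*} [RCLike 𝕜] {m n : ℕ} (lam : ℝ) (x : Fin n → 𝕜)
    (f : Fin m → 𝕜) : ℝ :=
  ∑ j, ‖x j‖ + lam * ∑ i, ‖f i‖

/-- `(x, f)` is a solution of the problem: minimize `‖x'‖₁ + lam ‖f'‖₁` subject to
`A x' + f' = y`. -/
def IsL1Solution {𝕜 : Type*} [RCLike 𝕜] {m n : ℕ} (A : Matrix (Fin m) (Fin n) 𝕜)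
    (y : Fin m → 𝕜) (lam : ℝ) (x : Fin n → 𝕜) (f : Fin m → 𝕜) : Prop :=
  A.mulVec x + f = y ∧
    ∀ (x' : Fin n → 𝕜) (f' : Fin m → 𝕜), A.mulVec x' + f' = y →
      l1Objective lam x f ≤ l1Objective lam x' f'

/-- `ℓ₁`-minimization with parameter `lam` from the observation `y = A x + f` is exact: the
minimization problem has `(x, f)` as its one and only solution. -/
def ExactRecovery {𝕜 : Type*} [RCLike 𝕜] {m n : ℕ} (A : Matrix (Fin m) (Fin n) 𝕜) (lam : ℝ)
    (x : Fin n → 𝕜) (f : Fin m → 𝕜) : Prop :=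
  ∀ (x' : Fin n → 𝕜) (f' : Fin m → 𝕜),
    IsL1Solution A (A.mulVec x + f) lam x' f' ↔ x' = x ∧ f' = f

/-!
Exact recovery follows from an approximate dual certificate, which is built by a golfing scheme
that needs only Bernstein's and Hoeffding's inequalities for scalars.

*Deterministic part.* Let `h` be a perturbation of the signal, so that the corruption moves by
`-A h`. The objective grows by at least
`Re ⟨sgn x - v, h⟩_T + ½ ‖h_{Tᶜ}‖₁ + (λ/2) ‖(A h)_{Bᶜ}‖₁` if `v = A* (y + λ sgn f)` where `y`
vanishes on `B`, `‖y‖_∞ ≤ λ/2` and `‖v‖_∞ ≤ 1/2` off `T`. If `v` is polynomially close to `sgn x`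
on `T`, it remains to bound `‖h_T‖₁` by a polynomial in `n` times the other two terms. Instead of
the least singular value of `A_{Bᶜ, T}`, this uses certificates of the same kind for the
coordinate vectors `e_j`, `j ∈ T`, which express `h_j` through `(A h)_{Bᶜ}` and `h_{Tᶜ}` up to a
small error (`exactRecovery_of_certificate`).

*Golfing.* Split the rows outside `B` into disjoint batches `J_k`, and let
`M_k = |J_k|⁻¹ ∑_{i ∈ J_k} a_i a_i*`, whose mean is the identity. Starting with
`q_0 = (sgn x - λ A* sgn f)_T`, set `q_{k+1} = (q_k - M_k q_k)_T`; then `∑_k M_k q_k` is in the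
range of `A*`, equals `q_0 - q_K` on `T`, and is small off `T`. As `q_k` does not depend on the
batch `J_k`, Bernstein's inequality applies to each coordinate of `M_k q_k - q_k`, and
`E |a* q|² = ‖q‖₂² ≤ |T| ‖q‖_∞²` makes the step a contraction in the sup norm as soon as `|J_k|`
is large compared with `μ |T| log n` (`IsSensingLaw.measureReal_not_golfGood_le`). So no
concentration of random matrices is required. Two batches with `≈ m` rows contract by a multiple
of `1/√(log n)` each, and `≈ log n` batches with `≈ m / log n` rows by `1/4`.

*The bound on `y`.* An entry of `y` is a multiple of `a_i* q_k` with `i ∈ J_k`. The Gram operators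
being self-adjoint, this is the pairing of `q_0` with the row `a_i`, golfed backwards through the
earlier batches. The golfed row is again small by the contraction property, and is independent of
the signs, so Hoeffding's inequality for `sgn x` and `sgn f` gains what the trivial bound on
`a_i* q_k` loses (`norm_herm_golf_start_le`). The choice `λ = 1/√(log n)` balances the factor
`√(log n)` in Hoeffding's bound on `A* sgn f`.
-/

/-! ### Exponential tail bounds for bounded scalars -/

/-- The four rotations `1, -1, I, -I` detect the size of a scalar, so a tail bound for the real
parts of all rotations of `W` gives one for `‖W‖`. -/
theorem measureReal_lt_norm_le_of_re {Ω 𝕜 : Type*} [RCLike 𝕜] [MeasurableSpace Ω] (P : Measure Ω)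
    [IsFiniteMeasure P] (W : Ω → 𝕜) (t ε : ℝ)
    (h : ∀ ζ : 𝕜, ‖ζ‖ ≤ 1 → P.real {ω | t / √2 < RCLike.re (ζ * W ω)} ≤ ε) :
    P.real {ω | t < ‖W ω‖} ≤ 4 * ε := by
  have key : {ω | t < ‖W ω‖} ⊆
      ({ω | t / √2 < RCLike.re ((1 : 𝕜) * W ω)} ∪ {ω | t / √2 < RCLike.re ((-1 : 𝕜) * W ω)}) ∪
      ({ω | t / √2 < RCLike.re ((RCLike.I : 𝕜) * W ω)} ∪
        {ω | t / √2 < RCLike.re ((-RCLike.I : 𝕜) * W ω)}) := by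
    intro ω hω
    simp only [Set.mem_ofPred_eq] at hω
    by_contra hcon
    simp only [Set.mem_union, Set.mem_ofPred_eq, not_or, not_lt, one_mul, neg_mul, map_neg,
      RCLike.I_mul_re, neg_neg] at hcon
    obtain ⟨⟨h1, h2⟩, h3, h4⟩ := hcon
    have hre : |RCLike.re (W ω)| ≤ t / √2 := abs_le.2 ⟨by linarith, h1⟩
    have him : |RCLike.im (W ω)| ≤ t / √2 := abs_le.2 ⟨by linarith, by linarith⟩
    have ht : 0 ≤ t / √2 := (abs_nonneg _).trans hre
    have e1 := sq_le_sq' (by linarith [abs_nonneg (RCLike.re (W ω))]) hre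
    have e2 := sq_le_sq' (by linarith [abs_nonneg (RCLike.im (W ω))]) him
    rw [sq_abs, div_pow, Real.sq_sqrt (by norm_num)] at e1 e2
    have e3 : ‖W ω‖ ^ 2 = RCLike.re (W ω) ^ 2 + RCLike.im (W ω) ^ 2 := by
      rw [← RCLike.normSq_eq_def', RCLike.normSq_apply]; ring
    have ht' : 0 ≤ t := by
      have := mul_nonneg ht (Real.sqrt_nonneg 2)
      rwa [div_mul_cancel₀ _ (by positivity)] at this
    nlinarith [norm_nonneg (W ω)]
  refine (measureReal_mono key).trans ?_
  refine (measureReal_union_le _ _).trans ?_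
  have a1 := h 1 (by simp)
  have a2 := h (-1) (by simp)
  have hI : ‖(RCLike.I : 𝕜)‖ ≤ 1 := by
    rcases eq_or_ne (RCLike.I : 𝕜) 0 with h0 | h0
    · simp [h0]
    · exact (RCLike.norm_I_of_ne_zero h0).le
  have a3 := h RCLike.I hI
  have a4 := h (-RCLike.I) (by rwa [norm_neg])
  have b1 := measureReal_union_le (μ := P) {ω | t / √2 < RCLike.re ((1 : 𝕜) * W ω)}
    {ω | t / √2 < RCLike.re ((-1 : 𝕜) * W ω)}
  have b2 := measureReal_union_le (μ := P) {ω | t / √2 < RCLike.re ((RCLike.I : 𝕜) * W ω)}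
    {ω | t / √2 < RCLike.re ((-RCLike.I : 𝕜) * W ω)}
  linarith

theorem mgf_le_exp_sq_mul {V : Type*} [MeasurableSpace V] {ν : Measure V} [IsProbabilityMeasure ν]
    {g : V → ℝ} (hg : Measurable g) (hmean : ∫ v, g v ∂ν = 0) {R σ θ : ℝ}
    (hb : ∀ᵐ v ∂ν, |g v| ≤ R) (hσ : ∫ v, g v ^ 2 ∂ν ≤ σ) (hθ : 0 ≤ θ) (hθR : θ * R ≤ 1) :
    mgf g ν θ ≤ Real.exp (θ ^ 2 * σ) := by
  have hgi : Integrable g ν := Integrable.of_bound hg.aestronglyMeasurable R (by simpa using hb)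
  have hg2 : Integrable (fun v => g v ^ 2) ν := by
    refine Integrable.of_bound (by fun_prop) (R ^ 2) ?_
    filter_upwards [hb] with v hv
    rw [Real.norm_eq_abs, abs_pow]
    exact pow_le_pow_left₀ (abs_nonneg _) hv 2
  have hle : ∀ᵐ v ∂ν, Real.exp (θ * g v) ≤ 1 + θ * g v + θ ^ 2 * g v ^ 2 := by
    filter_upwards [hb] with v hv
    have h1 : |θ * g v| ≤ 1 := by
      rw [abs_mul, abs_of_nonneg hθ]
      exact (mul_le_mul_of_nonneg_left hv hθ).trans hθR
    have := (abs_le.1 (Real.abs_exp_sub_one_sub_id_le h1)).2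
    nlinarith
  have hint : Integrable (fun v => 1 + θ * g v + θ ^ 2 * g v ^ 2) ν :=
    ((integrable_const _).add (hgi.const_mul _)).add (hg2.const_mul _)
  calc mgf g ν θ ≤ ∫ v, (1 + θ * g v + θ ^ 2 * g v ^ 2) ∂ν :=
        integral_mono_of_nonneg (ae_of_all _ fun v => (Real.exp_pos _).le) hint hle
    _ = 1 + θ ^ 2 * ∫ v, g v ^ 2 ∂ν := by
        have e1 := integral_add (f := fun v => 1 + θ * g v)
          ((integrable_const _).add (hgi.const_mul _)) (hg2.const_mul (θ ^ 2))
        have e2 := integral_add (f := fun _ => (1 : ℝ)) (integrable_const _) (hgi.const_mul θ)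
        rw [e1, e2, integral_const_mul, integral_const_mul, hmean]
        simp
    _ ≤ θ ^ 2 * σ + 1 := by nlinarith [sq_nonneg θ]
    _ ≤ Real.exp (θ ^ 2 * σ) := Real.add_one_le_exp _

/-- Bernstein's inequality, with the exponential parameter `θ` left free. -/
theorem measureReal_sum_ge_le_exp {ι V : Type*} [Fintype ι] [MeasurableSpace V] {ν : Measure V}
    [IsProbabilityMeasure ν] {g : V → ℝ} (hg : Measurable g) (hmean : ∫ v, g v ∂ν = 0)
    {R σ θ : ℝ} (hb : ∀ᵐ v ∂ν, |g v| ≤ R) (hσ : ∫ v, g v ^ 2 ∂ν ≤ σ) (hθ : 0 ≤ θ)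
    (hθR : θ * R ≤ 1) (J : Finset ι) (τ : ℝ) :
    (Measure.pi fun _ : ι => ν).real {a | τ ≤ ∑ i ∈ J, g (a i)} ≤
      Real.exp (-θ * τ + J.card * (θ ^ 2 * σ)) := by
  have hind : iIndepFun (fun (i : ι) (a : ι → V) => g (a i)) (Measure.pi fun _ : ι => ν) :=
    iIndepFun_pi (X := fun _ => g) fun _ => hg.aemeasurable
  have hmeas : ∀ i : ι, Measurable fun a : ι → V => g (a i) :=
    fun i => hg.comp (measurable_pi_apply i)
  have hmgf : ∀ i : ι, mgf (fun a : ι → V => g (a i)) (Measure.pi fun _ : ι => ν) θ =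
      mgf g ν θ := by
    intro i
    have := mgf_map (X := g) (μ := Measure.pi fun _ : ι => ν) (Y := fun a : ι → V => a i) (t := θ)
      (measurable_pi_apply i).aemeasurable
      (by rw [(measurePreserving_eval (fun _ : ι => ν) i).map_eq]; fun_prop)
    rw [(measurePreserving_eval (fun _ : ι => ν) i).map_eq] at this
    exact this.symm
  have hbd : ∀ᵐ a ∂(Measure.pi fun _ : ι => ν), ∀ i, |g (a i)| ≤ R := by
    rw [ae_all_iff]
    intro i
    exact (measurePreserving_eval (fun _ : ι => ν) i).quasiMeasurePreserving.ae hb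
  have hint : Integrable (fun a : ι → V => Real.exp (θ * (∑ i ∈ J, fun a : ι → V => g (a i)) a))
      (Measure.pi fun _ : ι => ν) := by
    refine Integrable.of_bound ?_ (Real.exp (θ * (J.card * R))) ?_
    · refine Measurable.aestronglyMeasurable ?_
      simp only [Finset.sum_apply]
      fun_prop
    · filter_upwards [hbd] with a ha
      rw [Real.norm_eq_abs, abs_of_pos (Real.exp_pos _), Real.exp_le_exp, Finset.sum_apply]
      refine mul_le_mul_of_nonneg_left ?_ hθ
      rw [← nsmul_eq_mul]
      exact Finset.sum_le_card_nsmul _ _ _ fun i _ => (le_abs_self _).trans (ha i)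
  have h1 := measure_ge_le_exp_mul_mgf (μ := Measure.pi fun _ : ι => ν)
    (X := ∑ i ∈ J, fun a : ι → V => g (a i)) τ hθ hint
  rw [hind.mgf_sum hmeas] at h1
  simp only [hmgf, Finset.prod_const, Finset.sum_apply] at h1
  refine h1.trans ?_
  rw [Real.exp_add, ← nsmul_eq_mul, Real.exp_nsmul]
  exact mul_le_mul_of_nonneg_left
    (pow_le_pow_left₀ mgf_nonneg (mgf_le_exp_sq_mul hg hmean hb hσ hθ hθR) _) (Real.exp_pos _).le

theorem measurable_sign : Measurable Real.sign := by
  unfold Real.sign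
  exact Measurable.ite measurableSet_Iio measurable_const
    (Measurable.ite measurableSet_Ioi measurable_const measurable_const)

theorem measurable_signsOn {Ω ι : Type*} [MeasurableSpace Ω] (T : Finset ι) {z : Ω → ι → ℝ}
    (hz : Measurable z) : Measurable fun ω => signsOn T (z ω) := by
  refine measurable_pi_lambda _ fun i => ?_
  exact measurable_sign.comp ((measurable_pi_apply (i : ι)).comp hz)

theorem abs_sign_le_one (x : ℝ) : |Real.sign x| ≤ 1 := by
  rcases Real.sign_apply_eq x with h | h | h <;> simp [h]

/-- A symmetric `±1` variable has mean zero. -/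
theorem HasRandomSigns.integral_eq_zero {Ω ι : Type*} [MeasurableSpace Ω] {P : Measure Ω}
    [IsProbabilityMeasure P] {T : Finset ι} {z : Ω → ι → ℝ} (h : HasRandomSigns P T z) (i : T) :
    ∫ ω, signsOn T (z ω) i ∂P = 0 := by
  have hm : Measurable fun ω => signsOn T (z ω) i :=
    (measurable_pi_apply i).comp (measurable_signsOn T h.measurable)
  have e : (fun ω => signsOn T (z ω) i) = fun ω =>
      Set.indicator {ω | signsOn T (z ω) i = 1} (fun _ => (1 : ℝ)) ω -
        Set.indicator {ω | signsOn T (z ω) i = -1} (fun _ => (1 : ℝ)) ω := by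
    funext ω
    rcases Real.sign_apply_eq (z ω i) with h | h | h <;>
      simp [Set.indicator_apply, signsOn, h] <;> norm_num
  have m1 : MeasurableSet {ω | signsOn T (z ω) i = 1} := hm (measurableSet_singleton 1)
  have m2 : MeasurableSet {ω | signsOn T (z ω) i = -1} := hm (measurableSet_singleton (-1))
  rw [e, integral_sub ((integrable_const _).indicator m1) ((integrable_const _).indicator m2),
    integral_indicator_const _ m1, integral_indicator_const _ m2, Measure.real, Measure.real,
    h.prob_pos, h.prob_neg, sub_self]

/-- Hoeffding's inequality for random signs, with real coefficients and with any upper bound `σ`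
on their sum of squares. -/
theorem HasRandomSigns.measureReal_ge_le {Ω ι : Type*} [MeasurableSpace Ω] {P : Measure Ω}
    [IsProbabilityMeasure P] {T : Finset ι} {z : Ω → ι → ℝ} (h : HasRandomSigns P T z)
    (c : T → ℝ) {σ τ : ℝ} (hσ : 0 < σ) (hc : ∑ i, c i ^ 2 ≤ σ) (hτ : 0 ≤ τ) :
    P.real {ω | τ ≤ ∑ i, c i * signsOn T (z ω) i} ≤ Real.exp (-τ ^ 2 / (2 * σ)) := by
  have hm : ∀ i : T, Measurable fun ω => signsOn T (z ω) i := fun i =>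
    (measurable_pi_apply i).comp (measurable_signsOn T h.measurable)
  have hs : ∀ i : T, HasSubgaussianMGF (fun ω => signsOn T (z ω) i) 1 P := by
    intro i
    have := hasSubgaussianMGF_of_mem_Icc_of_integral_eq_zero (μ := P) (a := -1) (b := 1)
      (hm i).aemeasurable (ae_of_all _ fun ω => abs_le.1 (abs_sign_le_one _))
      (h.integral_eq_zero i)
    convert this using 1
    rw [show ((1 : ℝ) - -1) = 2 by norm_num]
    ext
    norm_num
  have hci : iIndepFun (fun (i : T) ω => c i * signsOn T (z ω) i) P :=
    h.indep.comp (fun i y => c i * y) fun i => measurable_const_mul _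
  have hsub := HasSubgaussianMGF.sum_of_iIndepFun hci (s := Finset.univ)
    fun i _ => (hs i).const_mul (c i)
  have hsub' : HasSubgaussianMGF (fun ω => ∑ i, c i * signsOn T (z ω) i) ⟨σ, hσ.le⟩ P := by
    refine ⟨hsub.integrable_exp_mul, fun t => (hsub.mgf_le t).trans ?_⟩
    rw [Real.exp_le_exp]
    have hpar : ((∑ i : T, (⟨c i ^ 2, sq_nonneg (c i)⟩ * 1 : NNReal) : NNReal) : ℝ) ≤ σ := by
      rw [NNReal.coe_sum]
      refine (le_of_eq (Finset.sum_congr rfl fun i _ => ?_)).trans hc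
      exact mul_one (c i ^ 2)
    have h2 := mul_le_mul_of_nonneg_right hpar (sq_nonneg t)
    change _ ≤ σ * t ^ 2 / 2
    linarith
  exact hsub'.measure_ge_le hτ

/-- Hoeffding's inequality for random signs with real or complex coefficients, normalized by the
Euclidean norm of the coefficients. -/
theorem HasRandomSigns.measureReal_lt_norm_le {Ω ι 𝕜 : Type*} [RCLike 𝕜] [MeasurableSpace Ω]
    {P : Measure Ω} [IsProbabilityMeasure P] {T : Finset ι} {z : Ω → ι → ℝ}
    (h : HasRandomSigns P T z) (c : T → 𝕜) {t : ℝ} (ht : 0 ≤ t) :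
    P.real {ω | t * √(∑ i, ‖c i‖ ^ 2) < ‖∑ i, c i * ((signsOn T (z ω) i : ℝ) : 𝕜)‖} ≤
      4 * Real.exp (-t ^ 2 / 4) := by
  refine measureReal_lt_norm_le_of_re P _ _ _ fun ζ hζ => ?_
  have hre : ∀ ω, RCLike.re (ζ * ∑ i, c i * ((signsOn T (z ω) i : ℝ) : 𝕜)) =
      ∑ i, RCLike.re (ζ * c i) * signsOn T (z ω) i := by
    intro ω
    rw [Finset.mul_sum, map_sum]
    refine Finset.sum_congr rfl fun i _ => ?_
    rw [← mul_assoc, RCLike.re_mul_ofReal]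
  simp only [hre]
  set S := ∑ i, ‖c i‖ ^ 2 with hS
  have hle : ∀ i, |RCLike.re (ζ * c i)| ≤ ‖c i‖ := fun i =>
    (RCLike.abs_re_le_norm _).trans (by
      rw [norm_mul]; exact mul_le_of_le_one_left (norm_nonneg _) hζ)
  have hsum : ∑ i, RCLike.re (ζ * c i) ^ 2 ≤ S := Finset.sum_le_sum fun i _ => by
    rw [← sq_abs]; exact pow_le_pow_left₀ (abs_nonneg _) (hle i) 2
  have hS0 : 0 ≤ S := Finset.sum_nonneg fun i _ => sq_nonneg _
  rcases hS0.eq_or_lt with h0 | hpos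
  · have hz : ∀ i, RCLike.re (ζ * c i) = 0 := by
      intro i
      have := (Finset.sum_eq_zero_iff_of_nonneg fun i _ => sq_nonneg ‖c i‖).1 h0.symm i
        (Finset.mem_univ i)
      have h3 := hle i
      rw [pow_eq_zero_iff two_ne_zero] at this
      rw [this] at h3
      exact abs_nonpos_iff.1 h3
    simp only [hz, zero_mul, Finset.sum_const_zero]
    have : {ω : Ω | t * √S / √2 < 0} = ∅ := by
      ext ω
      simp only [Set.mem_ofPred_eq, Set.mem_empty_iff_false, iff_false, not_lt]
      positivity
    rw [this]
    simp [(Real.exp_pos _).le]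
  · refine (measureReal_mono ?_).trans ((h.measureReal_ge_le _ hpos hsum
      (τ := t * √S / √2) (by positivity)).trans (le_of_eq ?_))
    · intro ω hω
      simp only [Set.mem_ofPred_eq] at hω ⊢
      exact hω.le
    · congr 1
      rw [div_pow, mul_pow, Real.sq_sqrt hS0, Real.sq_sqrt (by norm_num)]
      field_simp
      norm_num

/-! ### Sampled Gram operators and the sensing law -/

section Gram

variable {𝕜 : Type*} [RCLike 𝕜] {m n : ℕ}

/-- The Hermitian product `a* u`, conjugate linear in the first argument. -/
noncomputable def herm (a u : Fin n → 𝕜) : 𝕜 := ∑ j, star (a j) * u j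

/-- The sampled Gram operator `u ↦ N⁻¹ ∑_{i ∈ J} a_i a_i* u` of the rows with index in `J`. The
normalization `N` need not be the cardinality of `J`. -/
noncomputable def gram (N : ℝ) (J : Finset (Fin m)) (a : Fin m → Fin n → 𝕜) (u : Fin n → 𝕜) :
    Fin n → 𝕜 :=
  fun j => (∑ i ∈ J, a i j * herm (a i) u) / (N : 𝕜)

theorem continuous_herm :
    Continuous fun p : (Fin n → 𝕜) × (Fin n → 𝕜) => herm p.1 p.2 := by
  unfold herm; fun_prop

theorem continuous_gram (N : ℝ) (J : Finset (Fin m)) :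
    Continuous fun p : (Fin m → Fin n → 𝕜) × (Fin n → 𝕜) => gram N J p.1 p.2 := by
  unfold gram herm
  simp only [div_eq_mul_inv]
  fun_prop

theorem gram_congr {N : ℝ} {J : Finset (Fin m)} {a b : Fin m → Fin n → 𝕜}
    (h : ∀ i ∈ J, a i = b i) (u : Fin n → 𝕜) : gram N J a u = gram N J b u := by
  funext j
  unfold gram
  rw [Finset.sum_congr rfl fun i hi => by rw [h i hi]]

theorem gram_zero (N : ℝ) (J : Finset (Fin m)) (a : Fin m → Fin n → 𝕜) :
    gram N J a 0 = 0 := by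
  funext j
  simp [gram, herm]

theorem sum_norm_le_of_support (T : Finset (Fin n)) {u : Fin n → 𝕜} (hu : ∀ j ∉ T, u j = 0) :
    ∑ j, ‖u j‖ ≤ T.card * ‖u‖ := by
  rw [← Finset.sum_subset (Finset.subset_univ T) (f := fun j => ‖u j‖)
    (fun j _ hj => by rw [hu j hj, norm_zero]), ← nsmul_eq_mul]
  exact Finset.sum_le_card_nsmul _ _ _ fun j _ => norm_le_pi_norm u j

theorem sum_norm_sq_le_of_support (T : Finset (Fin n)) {u : Fin n → 𝕜} (hu : ∀ j ∉ T, u j = 0) :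
    ∑ j, ‖u j‖ ^ 2 ≤ T.card * ‖u‖ ^ 2 := by
  rw [← Finset.sum_subset (Finset.subset_univ T) (f := fun j => ‖u j‖ ^ 2)
    (fun j _ hj => by rw [hu j hj, norm_zero]; norm_num), ← nsmul_eq_mul]
  exact Finset.sum_le_card_nsmul _ _ _ fun j _ =>
    pow_le_pow_left₀ (norm_nonneg _) (norm_le_pi_norm u j) 2

theorem norm_herm_le {a u : Fin n → 𝕜} {b : ℝ} (ha : ∀ j, ‖a j‖ ≤ b) :
    ‖herm a u‖ ≤ b * ∑ j, ‖u j‖ := by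
  rw [Finset.mul_sum]
  refine (norm_sum_le _ _).trans (Finset.sum_le_sum fun j _ => ?_)
  rw [norm_mul, norm_star]
  exact mul_le_mul_of_nonneg_right (ha j) (norm_nonneg _)

variable {ν : Measure (Fin n → 𝕜)} {μ : ℝ}

theorem IsSensingLaw.integrable_mul_star (h : IsSensingLaw ν μ) (j k : Fin n) :
    Integrable (fun v : Fin n → 𝕜 => v j * star (v k)) ν := by
  have := h.isProbabilityMeasure
  refine Integrable.of_bound (Continuous.aestronglyMeasurable (by fun_prop)) (√μ * √μ) ?_
  filter_upwards [h.bounded] with v hv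
  rw [norm_mul, norm_star]
  exact mul_le_mul (hv j) (hv k) (norm_nonneg _) (Real.sqrt_nonneg _)

theorem IsSensingLaw.one_le (h : IsSensingLaw ν μ) (hn : 0 < n) : 1 ≤ μ := by
  have := h.isProbabilityMeasure
  have h1 := h.isotropic ⟨0, hn⟩ ⟨0, hn⟩
  rw [if_pos rfl] at h1
  by_contra hlt
  push Not at hlt
  have hsq : √μ * √μ < 1 := by
    rcases le_total 0 μ with h0 | h0
    · rwa [Real.mul_self_sqrt h0]
    · rw [Real.sqrt_eq_zero_of_nonpos h0]; norm_num
  have h2 : ‖∫ v, v ⟨0, hn⟩ * star (v ⟨0, hn⟩) ∂ν‖ ≤ √μ * √μ := by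
    have h3 := norm_integral_le_of_norm_le_const (μ := ν) (C := √μ * √μ)
      (f := fun v : Fin n → 𝕜 => v ⟨0, hn⟩ * star (v ⟨0, hn⟩)) (by
        filter_upwards [h.bounded] with v hv
        rw [norm_mul, norm_star]
        exact mul_le_mul (hv _) (hv _) (norm_nonneg _) (Real.sqrt_nonneg _))
    simpa using h3
  rw [h1, norm_one] at h2
  linarith

theorem IsSensingLaw.integrable_mul_herm (h : IsSensingLaw ν μ) (u : Fin n → 𝕜) (j : Fin n) :
    Integrable (fun v : Fin n → 𝕜 => v j * herm v u) ν := by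
  unfold herm
  simp only [Finset.mul_sum, ← mul_assoc]
  exact integrable_finsetSum _ fun k _ => (h.integrable_mul_star j k).mul_const _

theorem IsSensingLaw.integral_mul_herm (h : IsSensingLaw ν μ) (u : Fin n → 𝕜) (j : Fin n) :
    ∫ v, v j * herm v u ∂ν = u j := by
  unfold herm
  simp only [Finset.mul_sum, ← mul_assoc]
  rw [integral_finsetSum _ fun k _ => (h.integrable_mul_star j k).mul_const _]
  simp only [integral_mul_const, h.isotropic]
  simp

theorem IsSensingLaw.integral_norm_herm_sq (h : IsSensingLaw ν μ) (u : Fin n → 𝕜) :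
    ∫ v, ‖herm v u‖ ^ 2 ∂ν = ∑ j, ‖u j‖ ^ 2 := by
  have e : ∀ v : Fin n → 𝕜, ((‖herm v u‖ ^ 2 : ℝ) : 𝕜) = ∑ j, star (u j) * (v j * herm v u) := by
    intro v
    rw [RCLike.ofReal_pow, ← RCLike.conj_mul]
    conv_lhs => enter [1]; unfold herm
    rw [map_sum, Finset.sum_mul]
    refine Finset.sum_congr rfl fun j _ => ?_
    simp only [RCLike.star_def, map_mul, RingHomCompTriple.comp_apply, RingHom.id_apply]
    ring
  have h1 : ((∫ v, ‖herm v u‖ ^ 2 ∂ν : ℝ) : 𝕜) = ((∑ j, ‖u j‖ ^ 2 : ℝ) : 𝕜) := by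
    rw [← integral_ofReal]
    simp only [e]
    rw [integral_finsetSum _ fun j _ => (h.integrable_mul_herm u j).const_mul _]
    simp only [integral_const_mul, h.integral_mul_herm, RCLike.star_def, RCLike.conj_mul]
    push_cast
    rfl
  exact RCLike.ofReal_injective h1

/-- Concentration of one coordinate of `gram N J a u` for a fixed `u` with support in `T`. -/
theorem IsSensingLaw.measureReal_gram_le (h : IsSensingLaw ν μ) (T : Finset (Fin n))
    {u : Fin n → 𝕜} (hu : ∀ j ∉ T, u j = 0) (J : Finset (Fin m)) {N κ : ℝ}
    (hJ : (J.card : ℝ) ≤ N) (hN : 0 < N) (hκ : 0 < κ) (hκ1 : κ ≤ 1) (j : Fin n) :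
    (Measure.pi fun _ : Fin m => ν).real
      {a | κ * ‖u‖ < ‖gram N J a u j - (J.card / N : ℝ) * u j‖} ≤
      4 * Real.exp (-(κ ^ 2 * N / (8 * μ * T.card))) := by
  have := h.isProbabilityMeasure
  have hn : 0 < n := j.pos
  have hμ : 1 ≤ μ := h.one_le hn
  rcases eq_or_ne u 0 with rfl | hu0
  · simp [gram_zero, Real.exp_nonneg]
  have hU : 0 < ‖u‖ := norm_pos_iff.2 hu0
  have hs : (1 : ℝ) ≤ T.card := by
    rcases T.eq_empty_or_nonempty with rfl | hT
    · exact absurd (funext fun j => hu j (by simp)) hu0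
    · exact_mod_cast hT.card_pos
  set s : ℝ := (T.card : ℝ) with hsdef
  set U := ‖u‖ with hUdef
  refine measureReal_lt_norm_le_of_re _ _ _ _ fun ζ hζ => ?_
  -- the centered summand
  set g : (Fin n → 𝕜) → ℝ := fun v => RCLike.re (ζ * (v j * herm v u - u j)) with hg
  have hgm : Measurable g := by
    refine Continuous.measurable ?_
    have : Continuous fun v : Fin n → 𝕜 => herm v u :=
      continuous_herm.comp (continuous_id.prodMk continuous_const)
    exact RCLike.continuous_re.comp (by fun_prop)
  have hint : Integrable (fun v : Fin n → 𝕜 => ζ * (v j * herm v u - u j)) ν :=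
    ((h.integrable_mul_herm u j).sub (integrable_const _)).const_mul _
  have hmean : ∫ v, g v ∂ν = 0 := by
    rw [hg, integral_re hint, integral_const_mul,
      integral_sub (h.integrable_mul_herm u j) (integrable_const _), h.integral_mul_herm]
    simp
  have hherm : ∀ᵐ v ∂ν, ‖v j * herm v u‖ ≤ μ * s * U := by
    filter_upwards [h.bounded] with v hv
    rw [norm_mul]
    calc ‖v j‖ * ‖herm v u‖ ≤ √μ * (√μ * (s * U)) := by
          refine mul_le_mul (hv j) ?_ (norm_nonneg _) (Real.sqrt_nonneg _)
          exact (norm_herm_le hv).trans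
            (mul_le_mul_of_nonneg_left (sum_norm_le_of_support T hu) (Real.sqrt_nonneg _))
      _ = μ * s * U := by
          rw [← mul_assoc, Real.mul_self_sqrt (by linarith)]; ring
  have hbd : ∀ᵐ v ∂ν, |g v| ≤ 2 * (μ * s * U) := by
    filter_upwards [hherm] with v hv
    have h1 : ‖u j‖ ≤ μ * s * U := by
      refine (norm_le_pi_norm u j).trans ?_
      have : 1 ≤ μ * s := one_le_mul_of_one_le_of_one_le hμ hs
      nlinarith
    calc |g v| ≤ ‖ζ * (v j * herm v u - u j)‖ := RCLike.abs_re_le_norm _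
      _ ≤ ‖v j * herm v u - u j‖ := by
          rw [norm_mul]; exact mul_le_of_le_one_left (norm_nonneg _) hζ
      _ ≤ ‖v j * herm v u‖ + ‖u j‖ := norm_sub_le _ _
      _ ≤ 2 * (μ * s * U) := by linarith
  have hvar : ∫ v, g v ^ 2 ∂ν ≤ μ * s * U ^ 2 := by
    -- centering only decreases the second moment
    set Y : (Fin n → 𝕜) → ℝ := fun v => RCLike.re (ζ * (v j * herm v u)) with hY
    have hYint : Integrable Y ν := ((h.integrable_mul_herm u j).const_mul ζ).re
    have hYmean : ∫ v, Y v ∂ν = RCLike.re (ζ * u j) := by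
      rw [hY, integral_re ((h.integrable_mul_herm u j).const_mul ζ), integral_const_mul,
        h.integral_mul_herm]
    have hgY : ∀ v, g v = Y v - ∫ v, Y v ∂ν := by
      intro v
      rw [hYmean]
      simp only [hg, hY, mul_sub, map_sub]
    have hvarle := variance_le_expectation_sq (μ := ν) hYint.aestronglyMeasurable
    rw [variance_eq_integral hYint.aemeasurable] at hvarle
    simp only [hgY]
    refine hvarle.trans ?_
    have hnorm : ∀ᵐ v ∂ν, ‖herm v u‖ ≤ √μ * (s * U) := by
      filter_upwards [h.bounded] with v hv
      exact (norm_herm_le hv).trans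
        (mul_le_mul_of_nonneg_left (sum_norm_le_of_support T hu) (Real.sqrt_nonneg _))
    have hcont : Continuous fun v : Fin n → 𝕜 => herm v u :=
      continuous_herm.comp (continuous_id.prodMk continuous_const)
    have hsqint : Integrable (fun v => ‖herm v u‖ ^ 2) ν := by
      refine Integrable.of_bound (Continuous.aestronglyMeasurable (by fun_prop))
        ((√μ * (s * U)) ^ 2) ?_
      filter_upwards [hnorm] with v hv
      rw [Real.norm_eq_abs, abs_of_nonneg (sq_nonneg _)]
      exact pow_le_pow_left₀ (norm_nonneg _) hv 2
    calc ∫ v, (Y ^ 2) v ∂ν ≤ ∫ v, μ * ‖herm v u‖ ^ 2 ∂ν := by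
          refine integral_mono_of_nonneg (ae_of_all _ fun v => sq_nonneg _)
            (hsqint.const_mul _) ?_
          filter_upwards [h.bounded] with v hv
          have h1 : |Y v| ≤ √μ * ‖herm v u‖ := by
            refine (RCLike.abs_re_le_norm _).trans ?_
            rw [norm_mul, norm_mul]
            refine (mul_le_of_le_one_left (by positivity) hζ).trans ?_
            exact mul_le_mul_of_nonneg_right (hv j) (norm_nonneg _)
          have h2 := pow_le_pow_left₀ (abs_nonneg _) h1 2
          rw [sq_abs, mul_pow, Real.sq_sqrt (by linarith)] at h2
          exact h2
      _ = μ * ∑ j, ‖u j‖ ^ 2 := by rw [integral_const_mul, h.integral_norm_herm_sq]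
      _ ≤ μ * s * U ^ 2 := by
          rw [mul_assoc]
          exact mul_le_mul_of_nonneg_left (sum_norm_sq_le_of_support T hu) (by linarith)
  have hμs : 0 < μ * s * U := by positivity
  have h2pos : (0 : ℝ) < √2 := by positivity
  have h2sq : √2 * √2 = 2 := Real.mul_self_sqrt (by norm_num)
  have h2one : 1 ≤ √2 := by nlinarith
  -- the optimal exponential parameter
  have hB := measureReal_sum_ge_le_exp (ι := Fin m) hgm hmean (θ := κ / (√2 * (2 * (μ * s * U))))
    hbd hvar (by positivity) (by
      rw [div_mul_eq_mul_div, div_le_one (by positivity)]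
      exact mul_le_mul_of_nonneg_right (hκ1.trans h2one) (by positivity)) J (N * (κ * U / √2))
  refine (measureReal_mono ?_).trans (hB.trans ?_)
  · intro a ha
    simp only [Set.mem_ofPred_eq] at ha ⊢
    have e : RCLike.re (ζ * (gram N J a u j - ((J.card / N : ℝ) : 𝕜) * u j)) =
        (∑ i ∈ J, g (a i)) / N := by
      have hN' : (N : 𝕜) ≠ 0 := by exact_mod_cast hN.ne'
      have e1 : ζ * (gram N J a u j - ((J.card / N : ℝ) : 𝕜) * u j) =
          ((N⁻¹ : ℝ) : 𝕜) * ∑ i ∈ J, ζ * (a i j * herm (a i) u - u j) := by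
        rw [← Finset.mul_sum, Finset.sum_sub_distrib, Finset.sum_const, nsmul_eq_mul]
        unfold gram
        push_cast
        field_simp
      rw [e1, RCLike.re_ofReal_mul, map_sum, inv_mul_eq_div]
    rw [e, lt_div_iff₀ hN] at ha
    linarith
  · rw [Real.exp_le_exp]
    have e1 : κ / (√2 * (2 * (μ * s * U))) * (N * (κ * U / √2)) =
        2 * (κ ^ 2 * N / (8 * μ * s)) := by
      have : κ / (√2 * (2 * (μ * s * U))) * (N * (κ * U / √2)) =
        κ ^ 2 * N * U / ((√2 * √2) * (2 * (μ * s * U))) := by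
          field_simp
      rw [this, h2sq]
      field_simp
      norm_num
    have e2 : (κ / (√2 * (2 * (μ * s * U)))) ^ 2 * (μ * s * U ^ 2) =
        κ ^ 2 / (8 * μ * s) := by
      have : (κ / (√2 * (2 * (μ * s * U)))) ^ 2 * (μ * s * U ^ 2) =
        κ ^ 2 * (μ * s * U ^ 2) / ((√2 * √2) * (2 * (μ * s * U)) ^ 2) := by
          field_simp
      rw [this, h2sq]
      field_simp
      norm_num
    rw [neg_mul, e1, e2]
    have h3 : (J.card : ℝ) * (κ ^ 2 / (8 * μ * s)) ≤ N * (κ ^ 2 / (8 * μ * s)) :=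
      mul_le_mul_of_nonneg_right hJ (by positivity)
    have h4 : N * (κ ^ 2 / (8 * μ * s)) = κ ^ 2 * N / (8 * μ * s) := by ring
    linarith

end Gram

/-! ### Conditioning on part of a product -/

theorem measureReal_prod_le_of_slice_left {X Y : Type*} [MeasurableSpace X] [MeasurableSpace Y]
    (P : Measure X) (Q : Measure Y) [IsProbabilityMeasure P] [IsProbabilityMeasure Q]
    {S : Set (X × Y)} (hS : MeasurableSet S) {ε : ℝ}
    (h : ∀ y, P.real {x | (x, y) ∈ S} ≤ ε) : (P.prod Q).real S ≤ ε := by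
  have hε : 0 ≤ ε := by
    obtain ⟨y⟩ : Nonempty Y := nonempty_of_isProbabilityMeasure Q
    exact measureReal_nonneg.trans (h y)
  refine ENNReal.toReal_le_of_le_ofReal hε ?_
  rw [Measure.prod_apply_symm hS]
  calc ∫⁻ y, P ((fun x => (x, y)) ⁻¹' S) ∂Q ≤ ∫⁻ _, ENNReal.ofReal ε ∂Q :=
        lintegral_mono fun y => by
          rw [← ENNReal.ofReal_toReal (measure_ne_top P _)]
          exact ENNReal.ofReal_le_ofReal (h y)
    _ = ENNReal.ofReal ε := by simp

theorem measureReal_prod_le_of_slice_right {X Y : Type*} [MeasurableSpace X] [MeasurableSpace Y]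
    (P : Measure X) (Q : Measure Y) [IsProbabilityMeasure P] [IsProbabilityMeasure Q]
    {S : Set (X × Y)} (hS : MeasurableSet S) {ε : ℝ}
    (h : ∀ x, Q.real {y | (x, y) ∈ S} ≤ ε) : (P.prod Q).real S ≤ ε := by
  have h1 := measureReal_prod_le_of_slice_left Q P (measurable_swap hS) (ε := ε) h
  rwa [← Measure.prod_swap, map_measureReal_apply measurable_swap hS]

/-- Replacing the coordinates outside `J` by those of an independent copy preserves the product
measure. -/
theorem map_piecewise_pi {ι V : Type*} [Fintype ι] [DecidableEq ι] [MeasurableSpace V]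
    (ν : Measure V) [IsProbabilityMeasure ν] (J : Finset ι) :
    ((Measure.pi fun _ : ι => ν).prod (Measure.pi fun _ : ι => ν)).map
      (fun p : (ι → V) × (ι → V) => J.piecewise p.1 p.2) = Measure.pi fun _ : ι => ν := by
  have hmeas : Measurable fun p : (ι → V) × (ι → V) => J.piecewise p.1 p.2 := by
    refine measurable_pi_lambda _ fun i => ?_
    by_cases hi : i ∈ J
    · simp only [Finset.piecewise_eq_of_mem _ _ _ hi]; fun_prop
    · simp only [Finset.piecewise_eq_of_notMem _ _ _ hi]; fun_prop
  refine (Measure.pi_eq fun s hs => ?_).symm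
  rw [Measure.map_apply hmeas (MeasurableSet.univ_pi hs)]
  have e : (fun p : (ι → V) × (ι → V) => J.piecewise p.1 p.2) ⁻¹' Set.univ.pi s =
      (Set.univ.pi fun i => if i ∈ J then s i else Set.univ) ×ˢ
        (Set.univ.pi fun i => if i ∈ J then Set.univ else s i) := by
    ext p
    simp only [Set.mem_preimage, Set.mem_pi, Set.mem_univ, true_implies, Set.mem_prod,
      ← forall_and]
    refine forall_congr' fun i => ?_
    by_cases hi : i ∈ J <;> simp [hi]
  rw [e, Measure.prod_prod, Measure.pi_pi, Measure.pi_pi, ← Finset.prod_mul_distrib]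
  refine Finset.prod_congr rfl fun i _ => ?_
  by_cases hi : i ∈ J <;> simp [hi]

/-- A bound on the probability of an event conditionally on all the coordinates outside `J` is a
bound on its probability. -/
theorem measureReal_pi_le_of_piecewise {ι V : Type*} [Fintype ι] [DecidableEq ι]
    [MeasurableSpace V] (ν : Measure V) [IsProbabilityMeasure ν] (J : Finset ι) {S : Set (ι → V)}
    (hS : MeasurableSet S) {ε : ℝ}
    (h : ∀ b : ι → V, (Measure.pi fun _ : ι => ν).real {a | J.piecewise a b ∈ S} ≤ ε) :
    (Measure.pi fun _ : ι => ν).real S ≤ ε := by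
  have hmeas : Measurable fun p : (ι → V) × (ι → V) => J.piecewise p.1 p.2 := by
    refine measurable_pi_lambda _ fun i => ?_
    by_cases hi : i ∈ J
    · simp only [Finset.piecewise_eq_of_mem _ _ _ hi]; fun_prop
    · simp only [Finset.piecewise_eq_of_notMem _ _ _ hi]; fun_prop
  rw [← map_piecewise_pi ν J, map_measureReal_apply hmeas hS]
  exact measureReal_prod_le_of_slice_left _ _ (hmeas hS) h

/-! ### The golfing iteration -/

section Golf

variable {𝕜 : Type*} [RCLike 𝕜] {m n : ℕ}

/-- One golfing step with the batch `J` of rows: the residual of `u` on `T` after subtracting the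
empirical Gram operator of the batch. -/
noncomputable def golfStep (T : Finset (Fin n)) (J : Finset (Fin m)) (a : Fin m → Fin n → 𝕜)
    (u : Fin n → 𝕜) : Fin n → 𝕜 :=
  fun j => if j ∈ T then u j - gram J.card J a u j else 0

/-- The residual after golfing along a list of batches, starting with the head of the list. -/
noncomputable def golf (T : Finset (Fin n)) (J : ℕ → Finset (Fin m)) (a : Fin m → Fin n → 𝕜)
    (l : List ℕ) (u : Fin n → 𝕜) : Fin n → 𝕜 :=
  l.foldl (fun w k => golfStep T (J k) a w) u

/-- Every golfing step along the list moves every coordinate, inside and outside of `T`, by at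
most `κ k` times the sup norm of the residual at hand. -/
def GolfGood (T : Finset (Fin n)) (J : ℕ → Finset (Fin m)) (κ : ℕ → ℝ) (a : Fin m → Fin n → 𝕜) :
    List ℕ → (Fin n → 𝕜) → Prop
  | [], _ => True
  | k :: l, u => (∀ j, ‖gram (J k).card (J k) a u j - u j‖ ≤ κ k * ‖u‖) ∧
      GolfGood T J κ a l (golfStep T (J k) a u)

theorem golf_cons (T : Finset (Fin n)) (J : ℕ → Finset (Fin m)) (a : Fin m → Fin n → 𝕜) (k : ℕ)
    (l : List ℕ) (u : Fin n → 𝕜) :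
    golf T J a (k :: l) u = golf T J a l (golfStep T (J k) a u) := rfl

theorem golf_append_singleton (T : Finset (Fin n)) (J : ℕ → Finset (Fin m))
    (a : Fin m → Fin n → 𝕜) (k : ℕ) (l : List ℕ) (u : Fin n → 𝕜) :
    golf T J a (l ++ [k]) u = golfStep T (J k) a (golf T J a l u) := by
  simp [golf]

theorem golfStep_support {T : Finset (Fin n)} {J : Finset (Fin m)} {a : Fin m → Fin n → 𝕜}
    {u : Fin n → 𝕜} {j : Fin n} (hj : j ∉ T) : golfStep T J a u j = 0 := if_neg hj

theorem golf_support {T : Finset (Fin n)} {J : ℕ → Finset (Fin m)} {a : Fin m → Fin n → 𝕜}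
    (l : List ℕ) {u : Fin n → 𝕜} (hu : ∀ j ∉ T, u j = 0) : ∀ j ∉ T, golf T J a l u j = 0 := by
  induction l generalizing u with
  | nil => exact hu
  | cons k l ih => exact ih fun j hj => golfStep_support hj

theorem GolfGood.append_singleton {T : Finset (Fin n)} {J : ℕ → Finset (Fin m)} {κ : ℕ → ℝ}
    {a : Fin m → Fin n → 𝕜} {l : List ℕ} {k : ℕ} {u : Fin n → 𝕜}
    (h : GolfGood T J κ a (l ++ [k]) u) : GolfGood T J κ a l u ∧
      ∀ j, ‖gram (J k).card (J k) a (golf T J a l u) j - golf T J a l u j‖ ≤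
        κ k * ‖golf T J a l u‖ := by
  induction l generalizing u with
  | nil => exact ⟨trivial, h.1⟩
  | cons k' l ih => exact ⟨⟨h.1, (ih h.2).1⟩, (ih h.2).2⟩

theorem norm_golfStep_le {T : Finset (Fin n)} {J : Finset (Fin m)} {κ : ℝ}
    {a : Fin m → Fin n → 𝕜} {u : Fin n → 𝕜}
    (h : ∀ j, ‖gram J.card J a u j - u j‖ ≤ κ * ‖u‖) (hκ : 0 ≤ κ) :
    ‖golfStep T J a u‖ ≤ κ * ‖u‖ := by
  rw [pi_norm_le_iff_of_nonneg (by positivity)]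
  intro j
  unfold golfStep
  split_ifs
  · rw [norm_sub_rev]; exact h j
  · rw [norm_zero]; positivity

theorem GolfGood.norm_golf_le {T : Finset (Fin n)} {J : ℕ → Finset (Fin m)} {κ : ℕ → ℝ}
    {a : Fin m → Fin n → 𝕜} {l : List ℕ} {u : Fin n → 𝕜} (h : GolfGood T J κ a l u)
    (hκ : ∀ k, 0 ≤ κ k) : ‖golf T J a l u‖ ≤ (l.map κ).prod * ‖u‖ := by
  induction l generalizing u with
  | nil => simp [golf]
  | cons k l ih =>
    rw [golf_cons, List.map_cons, List.prod_cons]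
    have hp : 0 ≤ (l.map κ).prod := List.prod_nonneg fun x hx => by
      obtain ⟨y, -, rfl⟩ := List.mem_map.1 hx
      exact hκ y
    calc _ ≤ (l.map κ).prod * ‖golfStep T (J k) a u‖ := ih h.2
      _ ≤ (l.map κ).prod * (κ k * ‖u‖) :=
          mul_le_mul_of_nonneg_left (norm_golfStep_le h.1 (hκ k)) hp
      _ = _ := by ring

theorem star_herm (a u : Fin n → 𝕜) : star (herm a u) = herm u a := by
  simp [herm, mul_comm]

/-- The Gram operator of a batch is self-adjoint. -/
theorem herm_gram_eq (N : ℝ) (J : Finset (Fin m)) (a : Fin m → Fin n → 𝕜) (w u : Fin n → 𝕜) :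
    herm w (gram N J a u) = (∑ i ∈ J, herm w (a i) * herm (a i) u) / (N : 𝕜) := by
  change ∑ j, star (w j) * ((∑ i ∈ J, a i j * herm (a i) u) / (N : 𝕜)) = _
  simp only [mul_div_assoc', ← Finset.sum_div, Finset.mul_sum]
  rw [Finset.sum_comm]
  congr 1
  refine Finset.sum_congr rfl fun i _ => ?_
  rw [show herm w (a i) = ∑ j, star (w j) * a i j from rfl, Finset.sum_mul]
  exact Finset.sum_congr rfl fun j _ => by ring

theorem herm_gram_comm (N : ℝ) (J : Finset (Fin m)) (a : Fin m → Fin n → 𝕜) (w u : Fin n → 𝕜) :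
    herm w (gram N J a u) = herm (gram N J a w) u := by
  rw [← star_herm u (gram N J a w), herm_gram_eq, herm_gram_eq]
  simp only [RCLike.star_def, map_div₀, map_sum, map_mul, RCLike.conj_ofReal]
  congr 1
  refine Finset.sum_congr rfl fun i _ => ?_
  simp only [← RCLike.star_def, star_herm]
  ring

theorem herm_golfStep_comm {T : Finset (Fin n)} (J : Finset (Fin m)) (a : Fin m → Fin n → 𝕜)
    {w u : Fin n → 𝕜} (hw : ∀ j ∉ T, w j = 0) (hu : ∀ j ∉ T, u j = 0) :
    herm w (golfStep T J a u) = herm (golfStep T J a w) u := by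
  have e1 : herm w (golfStep T J a u) = herm w u - herm w (gram J.card J a u) := by
    unfold herm
    rw [← Finset.sum_sub_distrib]
    refine Finset.sum_congr rfl fun j _ => ?_
    by_cases hj : j ∈ T
    · simp [golfStep, hj, mul_sub]
    · simp [hw j hj]
  have e2 : herm (golfStep T J a w) u = herm w u - herm (gram J.card J a w) u := by
    unfold herm
    rw [← Finset.sum_sub_distrib]
    refine Finset.sum_congr rfl fun j _ => ?_
    by_cases hj : j ∈ T
    · simp [golfStep, hj, sub_mul]
    · simp [hu j hj]
  rw [e1, e2, herm_gram_comm]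

/-- The adjoint of golfing along a list is golfing along the reversed list. -/
theorem herm_golf_comm {T : Finset (Fin n)} (J : ℕ → Finset (Fin m)) (a : Fin m → Fin n → 𝕜)
    (l : List ℕ) {w u : Fin n → 𝕜} (hw : ∀ j ∉ T, w j = 0) (hu : ∀ j ∉ T, u j = 0) :
    herm w (golf T J a l u) = herm (golf T J a l.reverse w) u := by
  induction l generalizing u with
  | nil => rfl
  | cons k l ih =>
    rw [golf_cons, ih fun j hj => golfStep_support hj, List.reverse_cons, golf_append_singleton,
      herm_golfStep_comm _ _ (golf_support _ hw) hu]

theorem measurable_golfStep {X : Type*} [MeasurableSpace X] (T : Finset (Fin n))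
    (J : Finset (Fin m)) {a : X → Fin m → Fin n → 𝕜} {u : X → Fin n → 𝕜} (ha : Measurable a)
    (hu : Measurable u) : Measurable fun x => golfStep T J (a x) (u x) := by
  have hg : Measurable fun x => gram J.card J (a x) (u x) :=
    (continuous_gram _ J).measurable.comp (ha.prodMk hu)
  refine measurable_pi_lambda _ fun j => ?_
  unfold golfStep
  split_ifs
  · exact ((measurable_pi_apply j).comp hu).sub ((measurable_pi_apply j).comp hg)
  · exact measurable_const

theorem measurable_golf {X : Type*} [MeasurableSpace X] (T : Finset (Fin n))
    (J : ℕ → Finset (Fin m)) (l : List ℕ) {a : X → Fin m → Fin n → 𝕜} {u : X → Fin n → 𝕜}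
    (ha : Measurable a) (hu : Measurable u) : Measurable fun x => golf T J (a x) l (u x) := by
  induction l generalizing u with
  | nil => exact hu
  | cons k l ih => exact ih (measurable_golfStep T (J k) ha hu)

theorem measurableSet_gram_step {X : Type*} [MeasurableSpace X] (N c κ : ℝ) (J : Finset (Fin m))
    {a : X → Fin m → Fin n → 𝕜} {u : X → Fin n → 𝕜} (ha : Measurable a) (hu : Measurable u) :
    MeasurableSet {x | ∀ j, ‖gram N J (a x) (u x) j - c * u x j‖ ≤ κ * ‖u x‖} := by
  have hg : Measurable fun x => gram N J (a x) (u x) :=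
    (continuous_gram _ J).measurable.comp (ha.prodMk hu)
  have : {x | ∀ j, ‖gram N J (a x) (u x) j - c * u x j‖ ≤ κ * ‖u x‖} =
      ⋂ j, {x | ‖gram N J (a x) (u x) j - c * u x j‖ ≤ κ * ‖u x‖} := by
    ext x; simp
  rw [this]
  refine MeasurableSet.iInter fun j => measurableSet_le ?_ (hu.norm.const_mul _)
  exact (((measurable_pi_apply j).comp hg).sub
    (((measurable_pi_apply j).comp hu).const_mul _)).norm

theorem measurableSet_golfGood {X : Type*} [MeasurableSpace X] (T : Finset (Fin n))
    (J : ℕ → Finset (Fin m)) (κ : ℕ → ℝ) (l : List ℕ) {a : X → Fin m → Fin n → 𝕜}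
    {u : X → Fin n → 𝕜} (ha : Measurable a) (hu : Measurable u) :
    MeasurableSet {x | GolfGood T J κ (a x) l (u x)} := by
  induction l generalizing u with
  | nil => simp [GolfGood]
  | cons k l ih =>
    have h1 := measurableSet_gram_step (J k).card 1 (κ k) (J k) ha hu
    simp only [RCLike.ofReal_one, one_mul] at h1
    exact h1.inter (ih (measurable_golfStep T (J k) ha hu))

variable {ν : Measure (Fin n → 𝕜)} {μ : ℝ}

/-- The deviation of a sampled Gram operator from its mean at a vector that does not depend on
the sampled rows. -/
theorem IsSensingLaw.measureReal_gram_of_indep (h : IsSensingLaw ν μ) (T : Finset (Fin n))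
    (J : Finset (Fin m)) {N κ : ℝ} (hJ : (J.card : ℝ) ≤ N) (hN : 0 < N) (hκ : 0 < κ)
    (hκ1 : κ ≤ 1) {Z : (Fin m → Fin n → 𝕜) → Fin n → 𝕜} (hZm : Measurable Z)
    (hZT : ∀ a, ∀ j ∉ T, Z a j = 0) (hZ : ∀ a b, (∀ i ∉ J, a i = b i) → Z a = Z b) :
    (Measure.pi fun _ : Fin m => ν).real
      {a | ¬ ∀ j, ‖gram N J a (Z a) j - (J.card / N : ℝ) * Z a j‖ ≤ κ * ‖Z a‖} ≤
      n * (4 * Real.exp (-(κ ^ 2 * N / (8 * μ * T.card)))) := by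
  classical
  have := h.isProbabilityMeasure
  refine measureReal_pi_le_of_piecewise ν J
    (measurableSet_gram_step N _ κ J measurable_id hZm).compl fun b => ?_
  have hsub : {a : Fin m → Fin n → 𝕜 | J.piecewise a b ∈
      {a | ¬ ∀ j, ‖gram N J a (Z a) j - (J.card / N : ℝ) * Z a j‖ ≤ κ * ‖Z a‖}} ⊆
      ⋃ j, {a | κ * ‖Z b‖ < ‖gram N J a (Z b) j - (J.card / N : ℝ) * Z b j‖} := by
    intro a ha
    simp only [Set.mem_ofPred_eq, not_forall, not_le] at ha
    obtain ⟨j, hj⟩ := ha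
    rw [hZ (J.piecewise a b) b fun i hi => Finset.piecewise_eq_of_notMem _ _ _ hi,
      gram_congr (fun i hi => Finset.piecewise_eq_of_mem J a b hi)] at hj
    exact Set.mem_iUnion.2 ⟨j, hj⟩
  refine (measureReal_mono hsub).trans ((measureReal_iUnion_fintype_le _).trans ?_)
  refine (Finset.sum_le_card_nsmul _ _ _ fun j _ =>
    h.measureReal_gram_le T (hZT b) J hJ hN hκ hκ1 j).trans (le_of_eq ?_)
  simp

/-- Golfing from a starting vector that does not depend on the rows of the batches succeeds with
high probability. -/
theorem IsSensingLaw.measureReal_not_golfGood_le (h : IsSensingLaw ν μ) (T : Finset (Fin n))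
    (J : ℕ → Finset (Fin m)) {κ : ℕ → ℝ} {ε : ℝ} (l : List ℕ)
    (hl : l.Pairwise fun k k' => Disjoint (J k) (J k'))
    (hκ : ∀ k ∈ l, 0 < κ k ∧ κ k ≤ 1) (hJ : ∀ k ∈ l, (J k).Nonempty)
    (hε : ∀ k ∈ l, 4 * Real.exp (-(κ k ^ 2 * (J k).card / (8 * μ * T.card))) ≤ ε)
    {Z : (Fin m → Fin n → 𝕜) → Fin n → 𝕜} (hZm : Measurable Z)
    (hZT : ∀ a, ∀ j ∉ T, Z a j = 0)
    (hZ : ∀ k ∈ l, ∀ a b, (∀ i ∉ J k, a i = b i) → Z a = Z b) :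
    (Measure.pi fun _ : Fin m => ν).real {a | ¬ GolfGood T J κ a l (Z a)} ≤
      l.length * (n * ε) := by
  have := h.isProbabilityMeasure
  induction l generalizing Z with
  | nil => simp [GolfGood]
  | cons k l ih =>
    have hJk : (0 : ℝ) < (J k).card := by exact_mod_cast (hJ k (by simp)).card_pos
    have h1 := h.measureReal_gram_of_indep T (J k) le_rfl hJk (hκ k (by simp)).1
      (hκ k (by simp)).2 hZm hZT (hZ k (by simp))
    simp only [div_self hJk.ne', RCLike.ofReal_one, one_mul] at h1
    have h2 := ih (Z := fun a => golfStep T (J k) a (Z a)) (List.pairwise_cons.1 hl).2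
      (fun k' hk' => hκ k' (by simp [hk'])) (fun k' hk' => hJ k' (by simp [hk']))
      (fun k' hk' => hε k' (by simp [hk'])) (measurable_golfStep T (J k) measurable_id hZm)
      (fun a j hj => golfStep_support hj) (by
        intro k' hk' a b hab
        have hd := (List.pairwise_cons.1 hl).1 k' hk'
        have e : gram (J k).card (J k) a (Z b) = gram (J k).card (J k) b (Z b) := by
          exact gram_congr (fun i hi => hab i (Finset.disjoint_left.1 hd hi)) _
        funext j
        simp only [golfStep, hZ k' (by simp [hk']) a b hab, e])
    have hsub : {a | ¬ GolfGood T J κ a (k :: l) (Z a)} ⊆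
        {a | ¬ ∀ j, ‖gram (J k).card (J k) a (Z a) j - Z a j‖ ≤ κ k * ‖Z a‖} ∪
          {a | ¬ GolfGood T J κ a l (golfStep T (J k) a (Z a))} := by
      intro a ha
      simp only [Set.mem_ofPred_eq, GolfGood, not_and_or] at ha
      exact ha
    refine (measureReal_mono hsub).trans ((measureReal_union_le _ _).trans ?_)
    have h3 := mul_le_mul_of_nonneg_left (hε k (by simp)) (Nat.cast_nonneg (α := ℝ) n)
    rw [List.length_cons]
    push_cast
    linarith

end Golf

/-! ### Exact recovery from an approximate dual certificate -/

section Certificate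

variable {𝕜 : Type*} [RCLike 𝕜] {m n : ℕ}

/-- The adjoint of the sensing matrix: `A* w = m^{-1/2} ∑ i, w_i a_i`. -/
noncomputable def sensingAdjoint (a : Fin m → Fin n → 𝕜) (w : Fin m → 𝕜) : Fin n → 𝕜 :=
  fun j => (∑ i, a i j * w i) / ((√(m : ℝ) : ℝ) : 𝕜)

theorem sensingMatrix_mulVec (a : Fin m → Fin n → 𝕜) (h : Fin n → 𝕜) (i : Fin m) :
    (sensingMatrix a).mulVec h i = herm (a i) h / ((√(m : ℝ) : ℝ) : 𝕜) := by
  simp only [sensingMatrix, Matrix.mulVec, dotProduct, Matrix.of_apply, herm, Finset.sum_div]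
  refine Finset.sum_congr rfl fun j _ => ?_
  push_cast
  ring

theorem herm_sensingAdjoint (a : Fin m → Fin n → 𝕜) (w : Fin m → 𝕜) (h : Fin n → 𝕜) :
    herm (sensingAdjoint a w) h = herm w ((sensingMatrix a).mulVec h) := by
  have e : herm w ((sensingMatrix a).mulVec h) =
      ∑ i, star (w i) * (herm (a i) h / ((√(m : ℝ) : ℝ) : 𝕜)) :=
    Finset.sum_congr rfl fun i _ => by rw [sensingMatrix_mulVec]
  rw [e]
  simp only [herm, sensingAdjoint, Finset.sum_div, Finset.mul_sum, RCLike.star_def, map_sum,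
    map_div₀, map_mul, RCLike.conj_ofReal, Finset.sum_mul]
  rw [Finset.sum_comm]
  refine Finset.sum_congr rfl fun i _ => Finset.sum_congr rfl fun j _ => ?_
  ring

theorem sign_mul_self_eq_abs (x : ℝ) : Real.sign x * x = |x| := by
  rcases lt_trichotomy x 0 with h | rfl | h
  · rw [Real.sign_of_neg h, abs_of_neg h]; ring
  · simp
  · rw [Real.sign_of_pos h, abs_of_pos h]; ring

/-- The sign is a subgradient of the norm at a real point. -/
theorem abs_add_sign_mul_re_le (x : ℝ) (z : 𝕜) :
    |x| + Real.sign x * RCLike.re z ≤ ‖(x : 𝕜) + z‖ := by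
  have h1 : Real.sign x * RCLike.re ((x : 𝕜) + z) ≤ |RCLike.re ((x : 𝕜) + z)| := by
    refine (le_abs_self _).trans ?_
    rw [abs_mul]
    exact mul_le_of_le_one_left (abs_nonneg _) (abs_sign_le_one x)
  have h2 := h1.trans (RCLike.abs_re_le_norm _)
  rw [map_add, RCLike.ofReal_re, mul_add, sign_mul_self_eq_abs] at h2
  exact h2

theorem neg_norm_mul_le_re (v z : 𝕜) : -(‖v‖ * ‖z‖) ≤ RCLike.re (star v * z) := by
  have := RCLike.abs_re_le_norm (star v * z)
  rw [norm_mul, norm_star] at this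
  exact (abs_le.1 this).1 |>.trans' (by linarith)

theorem re_le_norm_mul (v z : 𝕜) : RCLike.re (star v * z) ≤ ‖v‖ * ‖z‖ := by
  have := RCLike.re_le_norm (star v * z)
  rwa [norm_mul, norm_star] at this

/-- The vectors `w j` certify that a perturbation `h` cannot be concentrated on `T` while `A h` is
concentrated on `B`: each coordinate `h j`, `j ∈ T`, is nearly the pairing of `A h` with `w j`. -/
theorem sum_norm_le_of_coordinate_certificates (a : Fin m → Fin n → 𝕜) {T : Finset (Fin n)}
    {B : Finset (Fin m)} {Y η : ℝ} (w : Fin n → Fin m → 𝕜)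
    (hwB : ∀ j ∈ T, ∀ i ∈ B, w j i = 0) (hwY : ∀ j ∈ T, ∀ i, ‖w j i‖ ≤ Y)
    (hwT : ∀ j ∈ T, ∀ l ∈ T, ‖sensingAdjoint a (w j) l - (if l = j then 1 else 0)‖ ≤ η)
    (hwTc : ∀ j ∈ T, ∀ l ∉ T, ‖sensingAdjoint a (w j) l‖ ≤ 1)
    (hη : T.card * η ≤ 1 / 2) (h : Fin n → 𝕜) :
    ∑ j ∈ T, ‖h j‖ ≤ 2 * T.card *
      (Y * ∑ i ∈ Bᶜ, ‖(sensingMatrix a).mulVec h i‖ + ∑ j ∈ Tᶜ, ‖h j‖) := by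
  set d := (sensingMatrix a).mulVec h with hd
  set H := ∑ j ∈ T, ‖h j‖ with hH
  set G := ∑ j ∈ Tᶜ, ‖h j‖ with hG
  set D := ∑ i ∈ Bᶜ, ‖d i‖ with hD
  have hcoord : ∀ j ∈ T, ‖h j‖ ≤ Y * D + G + η * H := by
    intro j hj
    have e0 := herm_sensingAdjoint a (w j) h
    have e1 : h j = herm (w j) d -
        ∑ l, star (sensingAdjoint a (w j) l - (if l = j then 1 else 0)) * h l := by
      rw [← e0]
      simp [herm, sub_mul, Finset.sum_sub_distrib]
    have e2 : ‖herm (w j) d‖ ≤ Y * D := by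
      unfold herm
      rw [← Finset.sum_add_sum_compl B, Finset.sum_eq_zero (s := B) fun i hi => by
        rw [hwB j hj i hi, star_zero, zero_mul], zero_add, hD, Finset.mul_sum]
      refine (norm_sum_le _ _).trans (Finset.sum_le_sum fun i _ => ?_)
      rw [norm_mul, norm_star]
      exact mul_le_mul_of_nonneg_right (hwY j hj i) (norm_nonneg _)
    have e3 : ‖∑ l, star (sensingAdjoint a (w j) l - (if l = j then 1 else 0)) * h l‖ ≤
        η * H + G := by
      rw [← Finset.sum_add_sum_compl T]
      refine (norm_add_le _ _).trans (add_le_add ?_ ?_)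
      · rw [hH, Finset.mul_sum]
        refine (norm_sum_le _ _).trans (Finset.sum_le_sum fun l hl => ?_)
        rw [norm_mul, norm_star]
        exact mul_le_mul_of_nonneg_right (hwT j hj l hl) (norm_nonneg _)
      · refine (norm_sum_le _ _).trans (Finset.sum_le_sum fun l hl => ?_)
        have hl' : l ∉ T := Finset.mem_compl.1 hl
        have hlj : l ≠ j := fun e => hl' (by rw [e]; exact hj)
        rw [norm_mul, norm_star, if_neg hlj, sub_zero]
        exact mul_le_of_le_one_left (norm_nonneg _) (hwTc j hj l hl')
    have e4 := norm_sub_le (herm (w j) d)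
      (∑ l, star (sensingAdjoint a (w j) l - (if l = j then 1 else 0)) * h l)
    rw [← e1] at e4
    linarith
  have hsum : H ≤ T.card * (Y * D + G + η * H) := by
    rw [← nsmul_eq_mul]
    exact Finset.sum_le_card_nsmul _ _ _ hcoord
  have hH0 : 0 ≤ H := Finset.sum_nonneg fun _ _ => norm_nonneg _
  have h1 := mul_le_mul_of_nonneg_right hη hH0
  linarith

/-- An approximate dual certificate `y` for the sign pattern, together with approximate dual
certificates `w j` for the coordinate vectors of `T`, gives exact recovery. -/
theorem exactRecovery_of_certificate (a : Fin m → Fin n → 𝕜) {T : Finset (Fin n)}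
    {B : Finset (Fin m)} {x : Fin n → ℝ} {f : Fin m → ℝ} (hx : ∀ j ∉ T, x j = 0)
    (hf : ∀ i ∉ B, f i = 0) {lam δ Y η : ℝ} (hlam : 0 < lam) (y : Fin m → 𝕜)
    (hyB : ∀ i ∈ B, y i = 0) (hy : ∀ i, ‖y i‖ ≤ lam / 2)
    (hvT : ∀ j ∈ T, ‖sensingAdjoint a (fun i => y i + lam * (Real.sign (f i) : ℝ)) j -
      (Real.sign (x j) : ℝ)‖ ≤ δ)
    (hvTc : ∀ j ∉ T, ‖sensingAdjoint a (fun i => y i + lam * (Real.sign (f i) : ℝ)) j‖ ≤ 1 / 2)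
    (w : Fin n → Fin m → 𝕜)
    (hwB : ∀ j ∈ T, ∀ i ∈ B, w j i = 0) (hwY : ∀ j ∈ T, ∀ i, ‖w j i‖ ≤ Y)
    (hwT : ∀ j ∈ T, ∀ l ∈ T, ‖sensingAdjoint a (w j) l - (if l = j then 1 else 0)‖ ≤ η)
    (hwTc : ∀ j ∈ T, ∀ l ∉ T, ‖sensingAdjoint a (w j) l‖ ≤ 1)
    (hη : T.card * η ≤ 1 / 2) (hδ : 0 ≤ δ) (hδY : δ * (2 * T.card * Y) < lam / 2)
    (hδT : δ * (2 * T.card) < 1 / 2) :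
    ExactRecovery (sensingMatrix a) lam (fun j => (x j : 𝕜)) (fun i => (f i : 𝕜)) := by
  have key : ∀ (x' : Fin n → 𝕜) (f' : Fin m → 𝕜), (sensingMatrix a).mulVec x' + f' =
      (sensingMatrix a).mulVec (fun j => (x j : 𝕜)) + (fun i => (f i : 𝕜)) →
      x' ≠ (fun j => (x j : 𝕜)) →
      l1Objective lam (fun j => (x j : 𝕜)) (fun i => (f i : 𝕜)) < l1Objective lam x' f' := by
    intro x' f' hfeas hne
    set h : Fin n → 𝕜 := x' - fun j => (x j : 𝕜) with hh
    set d := (sensingMatrix a).mulVec h with hd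
    have hx' : ∀ j, x' j = (x j : 𝕜) + h j := fun j => by simp [hh]
    have hf' : ∀ i, f' i = (f i : 𝕜) + -d i := by
      intro i
      have h1 : d = (sensingMatrix a).mulVec x' - (sensingMatrix a).mulVec fun j => (x j : 𝕜) := by
        rw [hd, hh, Matrix.mulVec_sub]
      have h2 := congrFun hfeas i
      have h3 := congrFun h1 i
      simp only [Pi.add_apply, Pi.sub_apply] at h2 h3
      rw [h3]
      linear_combination h2
    set v := sensingAdjoint a (fun i => y i + lam * (Real.sign (f i) : ℝ)) with hv
    set H := ∑ j ∈ T, ‖h j‖ with hH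
    set G := ∑ j ∈ Tᶜ, ‖h j‖ with hG
    set D := ∑ i ∈ Bᶜ, ‖d i‖ with hD
    have hHle : H ≤ 2 * T.card * (Y * D + G) :=
      sum_norm_le_of_coordinate_certificates a w hwB hwY hwT hwTc hη h
    have hH0 : 0 ≤ H := Finset.sum_nonneg fun _ _ => norm_nonneg _
    have hG0 : 0 ≤ G := Finset.sum_nonneg fun _ _ => norm_nonneg _
    have hD0 : 0 ≤ D := Finset.sum_nonneg fun _ _ => norm_nonneg _
    have hX : ∑ j, (‖x' j‖ - |x j| - RCLike.re (star (v j) * h j)) ≥ -δ * H + 1 / 2 * G := by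
      rw [← Finset.sum_add_sum_compl T, hH, hG, Finset.mul_sum, Finset.mul_sum]
      refine add_le_add (Finset.sum_le_sum fun j hj => ?_) (Finset.sum_le_sum fun j hj => ?_)
      · have h1 := abs_add_sign_mul_re_le (x j) (h j)
        have h2 := re_le_norm_mul (v j - (Real.sign (x j) : ℝ)) (h j)
        have h3 := mul_le_mul_of_nonneg_right (hvT j hj) (norm_nonneg (h j))
        have h4 : RCLike.re (star (v j - (Real.sign (x j) : ℝ)) * h j) =
            RCLike.re (star (v j) * h j) - Real.sign (x j) * RCLike.re (h j) := by
          rw [star_sub, sub_mul, map_sub, RCLike.star_def, RCLike.conj_ofReal,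
            RCLike.re_ofReal_mul]
        rw [hx' j]
        linarith
      · have hj' := Finset.mem_compl.1 hj
        have h2 := re_le_norm_mul (v j) (h j)
        have h3 := mul_le_mul_of_nonneg_right (hvTc j hj') (norm_nonneg (h j))
        rw [hx' j, hx j hj']
        simp only [RCLike.ofReal_zero, zero_add, abs_zero]
        linarith
    have hF : ∑ i, (lam * (‖f' i‖ - |f i|) +
        RCLike.re (star (y i + lam * (Real.sign (f i) : ℝ)) * d i)) ≥ lam / 2 * D := by
      rw [← Finset.sum_add_sum_compl B, hD, Finset.mul_sum]
      refine le_add_of_nonneg_of_le (Finset.sum_nonneg fun i hi => ?_)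
        (Finset.sum_le_sum fun i hi => ?_)
      · have h1 := abs_add_sign_mul_re_le (f i) (-d i)
        rw [map_neg] at h1
        have h4 : RCLike.re (star (y i + lam * (Real.sign (f i) : ℝ)) * d i) =
            lam * (Real.sign (f i) * RCLike.re (d i)) := by
          rw [hyB i hi, zero_add, ← RCLike.ofReal_mul, RCLike.star_def, RCLike.conj_ofReal,
            RCLike.re_ofReal_mul, mul_assoc]
        rw [h4, hf' i, ← mul_add]
        exact mul_nonneg hlam.le (by linarith)
      · have hi' := Finset.mem_compl.1 hi
        have h2 := neg_norm_mul_le_re (y i) (d i)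
        have h3 := mul_le_mul_of_nonneg_right (hy i) (norm_nonneg (d i))
        rw [hf' i, hf i hi']
        simp only [RCLike.ofReal_zero, zero_add, abs_zero, Real.sign_zero, mul_zero, add_zero,
          norm_neg, sub_zero]
        linarith
    have hpair : ∑ j, RCLike.re (star (v j) * h j) =
        ∑ i, RCLike.re (star (y i + lam * (Real.sign (f i) : ℝ)) * d i) := by
      rw [← map_sum, ← map_sum]
      exact congrArg _ (herm_sensingAdjoint a _ h)
    have hobj : l1Objective lam x' f' -
        l1Objective lam (fun j => (x j : 𝕜)) (fun i => (f i : 𝕜)) ≥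
        -δ * H + 1 / 2 * G + lam / 2 * D := by
      simp only [Finset.sum_sub_distrib, Finset.sum_add_distrib, ← Finset.mul_sum] at hX hF
      simp only [l1Objective, RCLike.norm_ofReal]
      linarith
    have hδH := mul_le_mul_of_nonneg_left hHle hδ
    have hpos : 0 < G + D := by
      by_contra hcon
      have hG' : G = 0 := by linarith
      have hD' : D = 0 := by linarith
      rw [hG', hD', mul_zero, add_zero, mul_zero] at hHle
      have hH' : H = 0 := le_antisymm hHle hH0
      apply hne
      have hz : ∀ j, h j = 0 := by
        intro j
        by_cases hj : j ∈ T
        · exact norm_eq_zero.1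
            ((Finset.sum_eq_zero_iff_of_nonneg fun _ _ => norm_nonneg _).1 hH' j hj)
        · exact norm_eq_zero.1 ((Finset.sum_eq_zero_iff_of_nonneg fun _ _ => norm_nonneg _).1
            hG' j (Finset.mem_compl.2 hj))
      funext j
      rw [hx' j, hz j, add_zero]
    have : 0 < (1 / 2 - δ * (2 * T.card)) * G + (lam / 2 - δ * (2 * T.card * Y)) * D := by
      rcases hG0.eq_or_lt with hG' | hG'
      · rw [← hG', zero_add] at hpos
        rw [← hG', mul_zero, zero_add]
        exact mul_pos (by linarith) hpos
      · exact add_pos_of_pos_of_nonneg (mul_pos (by linarith) hG')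
          (mul_nonneg (by linarith) hD0)
    nlinarith
  intro x' f'
  constructor
  · rintro ⟨hfeas, hmin⟩
    have hxe : x' = fun j => (x j : 𝕜) := by
      by_contra hne
      exact absurd (hmin _ _ rfl) (not_le.2 (key x' f' hfeas hne))
    subst hxe
    exact ⟨rfl, add_left_cancel hfeas⟩
  · rintro ⟨rfl, rfl⟩
    refine ⟨rfl, fun x' f' hfeas => ?_⟩
    by_cases hne : x' = fun j => (x j : 𝕜)
    · subst hne
      rw [add_left_cancel hfeas]
    · exact (key x' f' hfeas hne).le

end Certificate

/-! ### The dual vectors produced by golfing -/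

section GolfDual

variable {𝕜 : Type*} [RCLike 𝕜] {m n : ℕ}

theorem prod_map_range_eq (κ : ℕ → ℝ) (k : ℕ) :
    ((List.range k).map κ).prod = ∏ i ∈ Finset.range k, κ i := by
  induction k with
  | zero => simp
  | succ k ih => rw [List.range_succ, List.map_append, List.prod_append, ih,
      Finset.prod_range_succ]; simp

theorem GolfGood.of_range {T : Finset (Fin n)} {J : ℕ → Finset (Fin m)} {κ : ℕ → ℝ}
    {a : Fin m → Fin n → 𝕜} {K : ℕ} {z : Fin n → 𝕜} (h : GolfGood T J κ a (List.range K) z)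
    {k : ℕ} (hk : k ≤ K) : GolfGood T J κ a (List.range k) z := by
  induction K with
  | zero => rwa [Nat.le_zero.1 hk]
  | succ K ih =>
    rcases hk.eq_or_lt with rfl | hlt
    · exact h
    · rw [List.range_succ] at h
      exact ih h.append_singleton.1 (Nat.lt_succ_iff.1 hlt)

theorem GolfGood.step_of_range {T : Finset (Fin n)} {J : ℕ → Finset (Fin m)} {κ : ℕ → ℝ}
    {a : Fin m → Fin n → 𝕜} {K : ℕ} {z : Fin n → 𝕜} (h : GolfGood T J κ a (List.range K) z)
    {k : ℕ} (hk : k < K) (j : Fin n) :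
    ‖gram (J k).card (J k) a (golf T J a (List.range k) z) j - golf T J a (List.range k) z j‖ ≤
      κ k * ‖golf T J a (List.range k) z‖ := by
  have h1 := h.of_range (k := k + 1) hk
  rw [List.range_succ] at h1
  exact h1.append_singleton.2 j

theorem GolfGood.norm_golf_range_le {T : Finset (Fin n)} {J : ℕ → Finset (Fin m)} {κ : ℕ → ℝ}
    {a : Fin m → Fin n → 𝕜} {K : ℕ} {z : Fin n → 𝕜} (h : GolfGood T J κ a (List.range K) z)
    (hκ : ∀ k, 0 ≤ κ k) {k : ℕ} (hk : k ≤ K) :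
    ‖golf T J a (List.range k) z‖ ≤ (∏ i ∈ Finset.range k, κ i) * ‖z‖ := by
  rw [← prod_map_range_eq]
  exact (h.of_range hk).norm_golf_le hκ

/-- The vector supported on the first `K` batches whose image under the adjoint of the sensing
matrix is the sum of the sampled Gram operators applied to the golfing residuals of `z`. -/
noncomputable def golfDual (T : Finset (Fin n)) (J : ℕ → Finset (Fin m)) (a : Fin m → Fin n → 𝕜)
    (K : ℕ) (z : Fin n → 𝕜) : Fin m → 𝕜 :=
  fun i => ∑ k ∈ Finset.range K, if i ∈ J k then
    ((√(m : ℝ) / (J k).card : ℝ) : 𝕜) * herm (a i) (golf T J a (List.range k) z) else 0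

theorem sensingAdjoint_golfDual (hm : 0 < m) (T : Finset (Fin n)) (J : ℕ → Finset (Fin m))
    (a : Fin m → Fin n → 𝕜) (K : ℕ) (z : Fin n → 𝕜) (j : Fin n) :
    sensingAdjoint a (golfDual T J a K z) j =
      ∑ k ∈ Finset.range K, gram (J k).card (J k) a (golf T J a (List.range k) z) j := by
  have hm' : ((√(m : ℝ) : ℝ) : 𝕜) ≠ 0 := by
    have : (0 : ℝ) < m := by exact_mod_cast hm
    exact_mod_cast (Real.sqrt_pos.2 this).ne'
  unfold sensingAdjoint golfDual gram
  simp only [Finset.mul_sum]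
  rw [Finset.sum_comm, Finset.sum_div]
  refine Finset.sum_congr rfl fun k _ => ?_
  rw [Finset.sum_div, Finset.sum_div,
    ← Finset.sum_subset (Finset.subset_univ (J k)) fun i _ hi => by simp [hi]]
  refine Finset.sum_congr rfl fun i hi => ?_
  rw [if_pos hi]
  push_cast
  field_simp

theorem sensingAdjoint_golfDual_of_mem (hm : 0 < m) {T : Finset (Fin n)} (J : ℕ → Finset (Fin m))
    (a : Fin m → Fin n → 𝕜) (K : ℕ) (z : Fin n → 𝕜) {j : Fin n} (hj : j ∈ T) :
    sensingAdjoint a (golfDual T J a K z) j = z j - golf T J a (List.range K) z j := by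
  rw [sensingAdjoint_golfDual hm]
  induction K with
  | zero => simp [golf]
  | succ K ih =>
    rw [Finset.sum_range_succ, ih, List.range_succ, golf_append_singleton, golfStep, if_pos hj]
    ring

theorem norm_sensingAdjoint_golfDual_of_notMem (hm : 0 < m) {T : Finset (Fin n)}
    {J : ℕ → Finset (Fin m)} {κ : ℕ → ℝ} {a : Fin m → Fin n → 𝕜} {K : ℕ} {z : Fin n → 𝕜}
    (hz : ∀ j ∉ T, z j = 0) (hκ : ∀ k, 0 ≤ κ k) (h : GolfGood T J κ a (List.range K) z)
    {j : Fin n} (hj : j ∉ T) :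
    ‖sensingAdjoint a (golfDual T J a K z) j‖ ≤
      (∑ k ∈ Finset.range K, ∏ i ∈ Finset.range (k + 1), κ i) * ‖z‖ := by
  rw [sensingAdjoint_golfDual hm, Finset.sum_mul]
  refine (norm_sum_le _ _).trans (Finset.sum_le_sum fun k hk => ?_)
  have hk' := Finset.mem_range.1 hk
  have h1 := h.step_of_range hk' j
  rw [golf_support _ hz j hj, sub_zero] at h1
  refine h1.trans ?_
  rw [Finset.prod_range_succ, mul_comm _ (κ k), mul_assoc]
  exact mul_le_mul_of_nonneg_left (h.norm_golf_range_le hκ hk'.le) (hκ k)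

theorem golfDual_eq_zero {T : Finset (Fin n)} {J : ℕ → Finset (Fin m)} {a : Fin m → Fin n → 𝕜}
    {K : ℕ} {z : Fin n → 𝕜} {i : Fin m} (hi : ∀ k < K, i ∉ J k) : golfDual T J a K z i = 0 :=
  Finset.sum_eq_zero fun k hk => if_neg (hi k (Finset.mem_range.1 hk))

theorem norm_golfDual_le {T : Finset (Fin n)} {J : ℕ → Finset (Fin m)} {a : Fin m → Fin n → 𝕜}
    {K : ℕ} {z : Fin n → 𝕜} (hJ : Pairwise fun k k' => Disjoint (J k) (J k')) {i : Fin m} {b : ℝ}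
    (hb : 0 ≤ b) (h : ∀ k < K, i ∈ J k →
      √(m : ℝ) / (J k).card * ‖herm (a i) (golf T J a (List.range k) z)‖ ≤ b) :
    ‖golfDual T J a K z i‖ ≤ b := by
  by_cases hi : ∃ k < K, i ∈ J k
  · obtain ⟨k, hk, hik⟩ := hi
    unfold golfDual
    rw [Finset.sum_eq_single k (fun k' _ hne => if_neg fun hik' =>
      Finset.disjoint_left.1 (hJ hne) hik' hik) (fun hk' => absurd (Finset.mem_range.2 hk) hk'),
      if_pos hik, norm_mul, RCLike.norm_ofReal, abs_of_nonneg (by positivity)]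
    exact h k hk hik
  · rw [golfDual_eq_zero fun k hk hik => hi ⟨k, hk, hik⟩, norm_zero]
    exact hb

/-! ### Samples on which the certificate exists -/

/-- The restriction of a vector to the coordinates in `T`. -/
def restrictTo (T : Finset (Fin n)) (u : Fin n → 𝕜) : Fin n → 𝕜 := fun j => if j ∈ T then u j else 0

/-- The start of the golfing scheme: the signs `σ` on `T`, corrected for the contribution
`lam A* φ` of the signs `φ` of the corruption. -/
noncomputable def golfStart (T : Finset (Fin n)) (lam : ℝ) (a : Fin m → Fin n → 𝕜)
    (σ : Fin n → ℝ) (φ : Fin m → ℝ) : Fin n → 𝕜 :=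
  restrictTo T fun j => (σ j : 𝕜) - lam * sensingAdjoint a (fun i => (φ i : 𝕜)) j

/-- The row `a i`, restricted to `T` and golfed backwards through the first `k` batches. Pairing
this vector with a starting vector equals pairing `a i` with the `k`-th residual. -/
noncomputable def golfedRow (T : Finset (Fin n)) (J : ℕ → Finset (Fin m))
    (a : Fin m → Fin n → 𝕜) (k : ℕ) (i : Fin m) : Fin n → 𝕜 :=
  golf T J a (List.range k).reverse (restrictTo T (a i))

/-- The conditions on the rows `a` alone: bounded entries, successful golfing from the coordinate
vectors and backwards from the rows, and a Gram operator of the corrupted rows `B` that is bounded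
at the golfed rows. -/
structure GoodRows (T : Finset (Fin n)) (B : Finset (Fin m)) (J : ℕ → Finset (Fin m)) (κ : ℕ → ℝ)
    (K : ℕ) (μ : ℝ) (a : Fin m → Fin n → 𝕜) : Prop where
  bounded : ∀ i j, ‖a i j‖ ≤ √μ
  golf_single : ∀ j ∈ T, GolfGood T J κ a (List.range K) (Pi.single j 1)
  golf_row : ∀ k < K, ∀ i ∈ J k, GolfGood T J κ a (List.range k).reverse (restrictTo T (a i))
  gram_corrupted : ∀ k < K, ∀ i ∈ J k, ∀ j, ‖gram m B a (golfedRow T J a k i) j -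
    ((B.card / m : ℝ) : 𝕜) * golfedRow T J a k i j‖ ≤ 1 * ‖golfedRow T J a k i‖

/-- Hoeffding-type bounds for the random signs `σ` and `φ`, paired with vectors that depend on the
rows only. -/
structure GoodSigns (T : Finset (Fin n)) (B : Finset (Fin m)) (J : ℕ → Finset (Fin m)) (K : ℕ)
    (t : ℝ) (a : Fin m → Fin n → 𝕜) (σ : Fin n → ℝ) (φ : Fin m → ℝ) : Prop where
  pair_signal : ∀ k < K, ∀ i ∈ J k, ‖∑ j ∈ T, star (golfedRow T J a k i j) * (σ j : 𝕜)‖ ≤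
    t * √(∑ j ∈ T, ‖star (golfedRow T J a k i j)‖ ^ 2)
  pair_corruption : ∀ k < K, ∀ i ∈ J k,
    ‖∑ i' ∈ B, herm (golfedRow T J a k i) (a i') / ((√(m : ℝ) : ℝ) : 𝕜) * (φ i' : 𝕜)‖ ≤
    t * √(∑ i' ∈ B, ‖herm (golfedRow T J a k i) (a i') / ((√(m : ℝ) : ℝ) : 𝕜)‖ ^ 2)
  adjoint_corruption : ∀ j, ‖∑ i ∈ B, a i j / ((√(m : ℝ) : ℝ) : 𝕜) * (φ i : 𝕜)‖ ≤
    t * √(∑ i ∈ B, ‖a i j / ((√(m : ℝ) : ℝ) : 𝕜)‖ ^ 2)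

theorem restrictTo_support {T : Finset (Fin n)} {u : Fin n → 𝕜} {j : Fin n} (hj : j ∉ T) :
    restrictTo T u j = 0 := if_neg hj

theorem herm_restrictTo {T : Finset (Fin n)} (a : Fin n → 𝕜) {u : Fin n → 𝕜}
    (hu : ∀ j ∉ T, u j = 0) : herm (restrictTo T a) u = herm a u := by
  refine Finset.sum_congr rfl fun j _ => ?_
  by_cases hj : j ∈ T
  · simp [restrictTo, hj]
  · simp [hu j hj]

theorem sensingAdjoint_eq_sum {a : Fin m → Fin n → 𝕜} {B : Finset (Fin m)} {φ : Fin m → ℝ}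
    (hφ : ∀ i ∉ B, φ i = 0) (j : Fin n) :
    sensingAdjoint a (fun i => (φ i : 𝕜)) j =
      ∑ i ∈ B, a i j / ((√(m : ℝ) : ℝ) : 𝕜) * (φ i : 𝕜) := by
  unfold sensingAdjoint
  rw [← Finset.sum_subset (Finset.subset_univ B) fun i _ hi => by simp [hφ i hi],
    Finset.sum_div]
  exact Finset.sum_congr rfl fun i _ => by ring

theorem GoodSigns.norm_sensingAdjoint_le {T : Finset (Fin n)} {B : Finset (Fin m)}
    {J : ℕ → Finset (Fin m)} {K : ℕ} {t μ : ℝ} {a : Fin m → Fin n → 𝕜} {σ : Fin n → ℝ}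
    {φ : Fin m → ℝ} (h : GoodSigns T B J K t a σ φ) (ht : 0 ≤ t) (hμ : 0 ≤ μ)
    (ha : ∀ i j, ‖a i j‖ ≤ √μ) (hφ : ∀ i ∉ B, φ i = 0) (j : Fin n) :
    ‖sensingAdjoint a (fun i => (φ i : 𝕜)) j‖ ≤ t * √(B.card * μ / m) := by
  rw [sensingAdjoint_eq_sum hφ]
  refine (h.adjoint_corruption j).trans (mul_le_mul_of_nonneg_left (Real.sqrt_le_sqrt ?_) ht)
  rw [mul_div_assoc, ← nsmul_eq_mul]
  refine Finset.sum_le_card_nsmul _ _ _ fun i _ => ?_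
  rw [norm_div, div_pow, RCLike.norm_ofReal, sq_abs, Real.sq_sqrt (Nat.cast_nonneg _)]
  refine div_le_div_of_nonneg_right ?_ (Nat.cast_nonneg _)
  have := pow_le_pow_left₀ (norm_nonneg _) (ha i j) 2
  rwa [Real.sq_sqrt hμ] at this

/-- The energy of the corrupted rows at a vector `u`, where their Gram operator is bounded. -/
theorem sum_norm_herm_sq_le {T : Finset (Fin n)} {B : Finset (Fin m)} (hm : 0 < m)
    {a : Fin m → Fin n → 𝕜} {u : Fin n → 𝕜} (hu : ∀ j ∉ T, u j = 0)
    (h : ∀ j, ‖gram m B a u j - ((B.card / m : ℝ) : 𝕜) * u j‖ ≤ 1 * ‖u‖) :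
    ∑ i ∈ B, ‖herm u (a i) / ((√(m : ℝ) : ℝ) : 𝕜)‖ ^ 2 ≤ 2 * T.card * ‖u‖ ^ 2 := by
  have hm0 : (0 : ℝ) < m := by exact_mod_cast hm
  have hB : (B.card / m : ℝ) ≤ 1 := by
    rw [div_le_one hm0]
    exact_mod_cast (Finset.card_le_univ B).trans_eq (Fintype.card_fin m)
  have e : ((∑ i ∈ B, ‖herm u (a i) / ((√(m : ℝ) : ℝ) : 𝕜)‖ ^ 2 : ℝ) : 𝕜) =
      herm u (gram m B a u) := by
    rw [herm_gram_eq, Finset.sum_div, RCLike.ofReal_sum]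
    refine Finset.sum_congr rfl fun i _ => ?_
    have e1 : ‖herm u (a i) / ((√(m : ℝ) : ℝ) : 𝕜)‖ ^ 2 = ‖herm u (a i)‖ ^ 2 / m := by
      rw [norm_div, div_pow, RCLike.norm_ofReal, sq_abs, Real.sq_sqrt (Nat.cast_nonneg _)]
    rw [e1, ← star_herm u (a i), RCLike.star_def, RCLike.mul_conj]
    push_cast
    rfl
  have hg : ∀ j, ‖gram m B a u j‖ ≤ 2 * ‖u‖ := by
    intro j
    have h1 := norm_sub_norm_le (gram m B a u j) (((B.card / m : ℝ) : 𝕜) * u j)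
    have h2 : ‖((B.card / m : ℝ) : 𝕜) * u j‖ ≤ ‖u‖ := by
      rw [norm_mul, RCLike.norm_ofReal, abs_of_nonneg (by positivity)]
      exact (mul_le_of_le_one_left (norm_nonneg _) hB).trans (norm_le_pi_norm u j)
    linarith [h j]
  have h1 : ‖herm u (gram m B a u)‖ ≤ 2 * ‖u‖ * ∑ j, ‖u j‖ := by
    rw [← star_herm, norm_star]
    exact norm_herm_le hg
  rw [← e, RCLike.norm_ofReal, abs_of_nonneg (Finset.sum_nonneg fun _ _ => sq_nonneg _)] at h1
  have h2 := mul_le_mul_of_nonneg_left (sum_norm_le_of_support T hu)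
    (show 0 ≤ 2 * ‖u‖ by positivity)
  nlinarith

theorem norm_golfStart_le {T : Finset (Fin n)} {lam b : ℝ} (hlam : 0 ≤ lam) (hb : 0 ≤ b)
    {a : Fin m → Fin n → 𝕜} {σ : Fin n → ℝ} {φ : Fin m → ℝ} (hσ : ∀ j, |σ j| ≤ 1)
    (h : ∀ j, lam * ‖sensingAdjoint a (fun i => (φ i : 𝕜)) j‖ ≤ b) :
    ‖golfStart T lam a σ φ‖ ≤ 1 + b := by
  rw [pi_norm_le_iff_of_nonneg (by linarith)]
  intro j
  unfold golfStart restrictTo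
  split_ifs
  · refine (norm_sub_le _ _).trans (add_le_add ?_ ?_)
    · rw [RCLike.norm_ofReal]; exact hσ j
    · rw [norm_mul, RCLike.norm_ofReal, abs_of_nonneg hlam]; exact h j
  · rw [norm_zero]; linarith

theorem golfedRow_support {T : Finset (Fin n)} {J : ℕ → Finset (Fin m)} {a : Fin m → Fin n → 𝕜}
    {k : ℕ} {i : Fin m} : ∀ j ∉ T, golfedRow T J a k i j = 0 :=
  golf_support _ fun _ hj => restrictTo_support hj

/-- The entries of the golfing dual vector, read backwards: they are pairings of golfed rows,
which depend on the rows only, with the random signs. -/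
theorem norm_herm_golf_start_le {T : Finset (Fin n)} {B : Finset (Fin m)}
    {J : ℕ → Finset (Fin m)} {κ : ℕ → ℝ} {K : ℕ} {t μ lam : ℝ} {a : Fin m → Fin n → 𝕜}
    {σ : Fin n → ℝ} {φ : Fin m → ℝ} (hm : 0 < m) (hrows : GoodRows T B J κ K μ a)
    (hsigns : GoodSigns T B J K t a σ φ) (hκ : ∀ k, 0 ≤ κ k) (ht : 0 ≤ t)
    (hlam : 0 ≤ lam) (hlam1 : lam ≤ 1) (hφ : ∀ i ∉ B, φ i = 0) {k : ℕ} (hk : k < K) {i : Fin m}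
    (hi : i ∈ J k) :
    ‖herm (a i) (golf T J a (List.range k) (golfStart T lam a σ φ))‖ ≤
      3 * t * √(T.card * μ) * ∏ l ∈ Finset.range k, κ l := by
  set u := golfedRow T J a k i with hu
  set z : Fin n → 𝕜 := golfStart T lam a σ φ with hz
  have hzT : ∀ j ∉ T, z j = 0 := fun j hj => restrictTo_support hj
  have huT : ∀ j ∉ T, u j = 0 := golfedRow_support
  have hprod : 0 ≤ ∏ l ∈ Finset.range k, κ l := Finset.prod_nonneg fun l _ => hκ l
  have hunorm : ‖u‖ ≤ (∏ l ∈ Finset.range k, κ l) * √μ := by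
    refine ((hrows.golf_row k hk i hi).norm_golf_le hκ).trans ?_
    rw [List.map_reverse, List.prod_reverse, prod_map_range_eq]
    refine mul_le_mul_of_nonneg_left ?_ hprod
    rw [pi_norm_le_iff_of_nonneg (Real.sqrt_nonneg _)]
    intro j
    unfold restrictTo
    split_ifs
    · exact hrows.bounded i j
    · rw [norm_zero]; exact Real.sqrt_nonneg _
  have e1 : herm (a i) (golf T J a (List.range k) z) = herm u z := by
    rw [← herm_restrictTo (T := T) (a i) (golf_support _ hzT),
      herm_golf_comm J a _ (fun j hj => restrictTo_support hj) hzT]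
    rfl
  have e2 : herm u z = ∑ j ∈ T, star (u j) * (σ j : 𝕜) -
      lam * ∑ i' ∈ B, herm u (a i') / ((√(m : ℝ) : ℝ) : 𝕜) * (φ i' : 𝕜) := by
    have e3 : ∑ i' ∈ B, herm u (a i') / ((√(m : ℝ) : ℝ) : 𝕜) * (φ i' : 𝕜) =
        ∑ j ∈ T, star (u j) * sensingAdjoint a (fun i => (φ i : 𝕜)) j := by
      simp only [sensingAdjoint_eq_sum hφ, Finset.mul_sum]
      rw [Finset.sum_comm]
      refine Finset.sum_congr rfl fun i' _ => ?_
      rw [herm, ← Finset.sum_subset (Finset.subset_univ T) fun j _ hj => by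
        rw [huT j hj, star_zero, zero_mul], Finset.sum_div, Finset.sum_mul]
      exact Finset.sum_congr rfl fun j _ => by ring
    rw [e3, Finset.mul_sum, ← Finset.sum_sub_distrib, herm,
      ← Finset.sum_subset (Finset.subset_univ T) fun j _ hj => by
        rw [huT j hj, star_zero, zero_mul]]
    refine Finset.sum_congr rfl fun j hj => ?_
    rw [hz, golfStart, restrictTo, if_pos hj]
    ring
  have b1 : ‖∑ j ∈ T, star (u j) * (σ j : 𝕜)‖ ≤ t * (√(T.card) * ‖u‖) := by
    refine (hsigns.pair_signal k hk i hi).trans (mul_le_mul_of_nonneg_left ?_ ht)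
    refine Real.sqrt_le_iff.2 ⟨by positivity, ?_⟩
    rw [mul_pow, Real.sq_sqrt (Nat.cast_nonneg _)]
    simp only [norm_star]
    refine le_trans ?_ (sum_norm_sq_le_of_support T huT)
    exact Finset.sum_le_sum_of_subset_of_nonneg (Finset.subset_univ _) fun _ _ _ => sq_nonneg _
  have b2 : ‖∑ i' ∈ B, herm u (a i') / ((√(m : ℝ) : ℝ) : 𝕜) * (φ i' : 𝕜)‖ ≤
      t * (2 * (√(T.card) * ‖u‖)) := by
    refine (hsigns.pair_corruption k hk i hi).trans (mul_le_mul_of_nonneg_left ?_ ht)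
    refine Real.sqrt_le_iff.2 ⟨by positivity, ?_⟩
    rw [mul_pow, mul_pow, Real.sq_sqrt (Nat.cast_nonneg _)]
    refine (sum_norm_herm_sq_le hm huT (hrows.gram_corrupted k hk i hi)).trans ?_
    have : 0 ≤ (T.card : ℝ) * ‖u‖ ^ 2 := by positivity
    linarith
  rw [e1, e2]
  have b3 : ‖(lam : 𝕜) * ∑ i' ∈ B, herm u (a i') / ((√(m : ℝ) : ℝ) : 𝕜) * (φ i' : 𝕜)‖ ≤
      t * (2 * (√(T.card) * ‖u‖)) := by
    rw [norm_mul, RCLike.norm_ofReal, abs_of_nonneg hlam]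
    exact (mul_le_of_le_one_left (norm_nonneg _) hlam1).trans b2
  have b4 : t * √(T.card) * ‖u‖ ≤ t * √(T.card) * ((∏ l ∈ Finset.range k, κ l) * √μ) :=
    mul_le_mul_of_nonneg_left hunorm (by positivity)
  refine (norm_sub_le _ _).trans ((add_le_add b1 b3).trans ?_)
  rw [Real.sqrt_mul (Nat.cast_nonneg _)]
  linarith

/-- On a good sample the golfing scheme provides all dual certificates, under numerical
conditions on the batch sizes and the contraction factors. -/
theorem exactRecovery_of_goodSample {T : Finset (Fin n)} {B : Finset (Fin m)}
    {J : ℕ → Finset (Fin m)} {κ : ℕ → ℝ} {K : ℕ} {t μ lam : ℝ} {a : Fin m → Fin n → 𝕜}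
    {x : Fin n → ℝ} {f : Fin m → ℝ} (hm : 0 < m)
    (hx : ∀ j ∉ T, x j = 0) (hf : ∀ i ∉ B, f i = 0)
    (hrows : GoodRows T B J κ K μ a)
    (hsigns : GoodSigns T B J K t a (fun j => Real.sign (x j)) (fun i => Real.sign (f i)))
    (hstart : GolfGood T J κ a (List.range K)
      (golfStart T lam a (fun j => Real.sign (x j)) (fun i => Real.sign (f i))))
    (hJ : Pairwise fun k k' => Disjoint (J k) (J k')) (hJB : ∀ k, Disjoint (J k) B)
    (hκ : ∀ k, 0 ≤ κ k) (hκ1 : ∀ k, κ k ≤ 1) (ht : 0 ≤ t) (hμ : 0 ≤ μ)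
    (hlam : 0 < lam) (hlam1 : lam ≤ 1)
    (hcorr : lam * (t * √(B.card * μ / m)) ≤ 1 / 8)
    (hsum : ∑ k ∈ Finset.range K, ∏ i ∈ Finset.range (k + 1), κ i ≤ 1 / 8)
    (hentry : ∀ k < K, √(m : ℝ) / (J k).card *
      (3 * t * √(T.card * μ) * ∏ l ∈ Finset.range k, κ l) ≤ lam / 2)
    (hend : 2 * (∏ l ∈ Finset.range K, κ l) * (2 * T.card) < 1 / 2)
    (hendY : 2 * (∏ l ∈ Finset.range K, κ l) * (2 * T.card * (√(m : ℝ) * (√μ * T.card))) <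
      lam / 2) :
    ExactRecovery (sensingMatrix a) lam (fun j => (x j : 𝕜)) (fun i => (f i : 𝕜)) := by
  have hφ : ∀ i ∉ B, Real.sign (f i) = 0 := fun i hi => by rw [hf i hi, Real.sign_zero]
  have hprod : ∀ k, 0 ≤ ∏ l ∈ Finset.range k, κ l := fun k => Finset.prod_nonneg fun l _ => hκ l
  have hprod1 : ∀ k, ∏ l ∈ Finset.range k, κ l ≤ 1 := fun k =>
    Finset.prod_le_one (fun l _ => hκ l) fun l _ => hκ1 l
  set z : Fin n → 𝕜 :=
    golfStart T lam a (fun j => Real.sign (x j)) (fun i => Real.sign (f i)) with hz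
  have hzT : ∀ j ∉ T, z j = 0 := fun j hj => restrictTo_support hj
  have hadj : ∀ j, lam * ‖sensingAdjoint a (fun i => ((Real.sign (f i) : ℝ) : 𝕜)) j‖ ≤ 1 / 8 :=
    fun j => (mul_le_mul_of_nonneg_left
      (hsigns.norm_sensingAdjoint_le ht hμ hrows.bounded hφ j) hlam.le).trans hcorr
  have hznorm : ‖z‖ ≤ 2 := by
    have := norm_golfStart_le (T := T) hlam.le (show (0 : ℝ) ≤ 1 / 8 by norm_num)
      (fun j => abs_sign_le_one (x j)) hadj
    linarith
  have hv : ∀ j, sensingAdjoint a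
      (fun i => golfDual T J a K z i + lam * ((Real.sign (f i) : ℝ) : 𝕜)) j =
      sensingAdjoint a (golfDual T J a K z) j +
        lam * sensingAdjoint a (fun i => ((Real.sign (f i) : ℝ) : 𝕜)) j := by
    intro j
    simp only [sensingAdjoint, mul_add, Finset.sum_add_distrib, add_div, Finset.mul_sum,
      mul_div_assoc']
    congr 2
    exact Finset.sum_congr rfl fun i _ => by ring
  have hsingT : ∀ j ∈ T, ∀ l ∉ T, (Pi.single j 1 : Fin n → 𝕜) l = 0 := fun j hj l hl =>
    Pi.single_eq_of_ne (fun e => hl (by rw [e]; exact hj)) _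
  have hsingnorm : ∀ j : Fin n, ‖(Pi.single j 1 : Fin n → 𝕜)‖ ≤ 1 := by
    intro j
    rw [pi_norm_le_iff_of_nonneg zero_le_one]
    intro l
    rcases eq_or_ne l j with rfl | hne
    · simp
    · rw [Pi.single_eq_of_ne hne, norm_zero]; exact zero_le_one
  have hB0 : ∀ w : Fin n → 𝕜, ∀ i ∈ B, golfDual T J a K w i = 0 := fun w i hi =>
    golfDual_eq_zero fun k _ hik => Finset.disjoint_left.1 (hJB k) hik hi
  refine exactRecovery_of_certificate a (T := T) (B := B) hx hf hlam
    (δ := 2 * ∏ l ∈ Finset.range K, κ l) (Y := √(m : ℝ) * (√μ * T.card))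
    (η := ∏ l ∈ Finset.range K, κ l) (golfDual T J a K z) (hB0 z) ?_ ?_ ?_
    (fun j => golfDual T J a K (Pi.single j 1)) (fun j _ => hB0 _) ?_ ?_ ?_ ?_ ?_ hendY hend
  · intro i
    refine norm_golfDual_le hJ (by linarith) fun k hk hik => ?_
    refine le_trans (mul_le_mul_of_nonneg_left ?_ (by positivity)) (hentry k hk)
    exact norm_herm_golf_start_le hm hrows hsigns hκ ht hlam.le hlam1 hφ hk hik
  · intro j hj
    rw [hv, sensingAdjoint_golfDual_of_mem hm J a K z hj]
    have e : z j = ((Real.sign (x j) : ℝ) : 𝕜) -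
        lam * sensingAdjoint a (fun i => ((Real.sign (f i) : ℝ) : 𝕜)) j := if_pos hj
    have e2 : z j - golf T J a (List.range K) z j +
        lam * sensingAdjoint a (fun i => ((Real.sign (f i) : ℝ) : 𝕜)) j -
        ((Real.sign (x j) : ℝ) : 𝕜) = -golf T J a (List.range K) z j := by
      rw [e]; ring
    rw [e2, norm_neg]
    refine (norm_le_pi_norm _ j).trans ((hstart.norm_golf_range_le hκ le_rfl).trans ?_)
    have := mul_le_mul_of_nonneg_left hznorm (hprod K)
    linarith
  · intro j hj
    rw [hv]
    have h1 := norm_sensingAdjoint_golfDual_of_notMem hm hzT hκ hstart hj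
    have h2 := norm_add_le (sensingAdjoint a (golfDual T J a K z) j)
      (lam * sensingAdjoint a (fun i => ((Real.sign (f i) : ℝ) : 𝕜)) j)
    have h3 := hadj j
    rw [norm_mul, RCLike.norm_ofReal, abs_of_pos hlam] at h2
    have h4 := mul_le_mul hsum hznorm (norm_nonneg _) (by norm_num)
    linarith
  · intro j hj i
    refine norm_golfDual_le hJ (by positivity) fun k hk hik => ?_
    have hg := hrows.golf_single j hj
    have hc : (1 : ℝ) ≤ (J k).card := by exact_mod_cast Finset.card_pos.2 ⟨i, hik⟩
    refine mul_le_mul (div_le_self (Real.sqrt_nonneg _) hc) ?_ (norm_nonneg _)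
      (Real.sqrt_nonneg _)
    refine (norm_herm_le (hrows.bounded i)).trans
      (mul_le_mul_of_nonneg_left ?_ (Real.sqrt_nonneg _))
    refine (sum_norm_le_of_support T (golf_support _ (hsingT j hj))).trans ?_
    refine mul_le_of_le_one_right (Nat.cast_nonneg _) ?_
    refine (hg.norm_golf_range_le hκ hk.le).trans ?_
    exact mul_le_one₀ (hprod1 k) (norm_nonneg _) (hsingnorm j)
  · intro j hj l hl
    have hg := hrows.golf_single j hj
    rw [sensingAdjoint_golfDual_of_mem hm J a K _ hl, Pi.single_apply, sub_sub_cancel_left,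
      norm_neg]
    refine (norm_le_pi_norm _ l).trans ((hg.norm_golf_range_le hκ le_rfl).trans ?_)
    exact mul_le_of_le_one_right (hprod K) (hsingnorm j)
  · intro j hj l hl
    have hg := hrows.golf_single j hj
    have h1 := norm_sensingAdjoint_golfDual_of_notMem hm (hsingT j hj) hκ hg hl
    have h4 := mul_le_mul hsum (hsingnorm j) (norm_nonneg _) (by norm_num)
    linarith
  · have h1 : 0 ≤ (∏ l ∈ Finset.range K, κ l) * T.card := mul_nonneg (hprod K) (Nat.cast_nonneg _)
    linarith
  · have := hprod K
    linarith

end GolfDual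

/-! ### Probability of a good sample -/

section Probability

variable {𝕜 : Type*} [RCLike 𝕜] {m n : ℕ}

theorem IndepFun.measureReal_le_of_slice {Ω X Y : Type*} [MeasurableSpace Ω] [MeasurableSpace X]
    [MeasurableSpace Y] {P : Measure Ω} [IsProbabilityMeasure P] {f : Ω → X} {g : Ω → Y}
    (h : IndepFun f g P) (hf : Measurable f) (hg : Measurable g) {S : Set (X × Y)}
    (hS : MeasurableSet S) {ε : ℝ} (hε : ∀ x, P.real {ω | (x, g ω) ∈ S} ≤ ε) :
    P.real {ω | (f ω, g ω) ∈ S} ≤ ε := by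
  have h1 := Measure.isProbabilityMeasure_map (μ := P) hf.aemeasurable
  have h2 := Measure.isProbabilityMeasure_map (μ := P) hg.aemeasurable
  have e := (indepFun_iff_map_prod_eq_prod_map_map hf.aemeasurable hg.aemeasurable).1 h
  have e2 : P.real {ω | (f ω, g ω) ∈ S} = (P.map fun ω => (f ω, g ω)).real S := by
    rw [map_measureReal_apply (hf.prodMk hg) hS]; rfl
  rw [e2, e]
  refine measureReal_prod_le_of_slice_right _ _ hS fun x => ?_
  have h3 : MeasurableSet {y | (x, y) ∈ S} := measurable_prodMk_left hS
  rw [map_measureReal_apply hg h3]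
  exact hε x

/-- Hoeffding's inequality with random coefficients that are independent of the signs. -/
theorem HasRandomSigns.measureReal_lt_norm_le_of_indepFun {Ω ι X : Type*} [MeasurableSpace Ω]
    [MeasurableSpace X] {P : Measure Ω} [IsProbabilityMeasure P] {T : Finset ι} {z : Ω → ι → ℝ}
    (h : HasRandomSigns P T z) {a : Ω → X} (ha : Measurable a)
    (hind : IndepFun a (fun ω => signsOn T (z ω)) P) {c : X → T → 𝕜} (hc : Measurable c) {t : ℝ}
    (ht : 0 ≤ t) :
    P.real {ω | t * √(∑ i, ‖c (a ω) i‖ ^ 2) <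
      ‖∑ i, c (a ω) i * ((signsOn T (z ω) i : ℝ) : 𝕜)‖} ≤ 4 * Real.exp (-t ^ 2 / 4) := by
  refine IndepFun.measureReal_le_of_slice hind ha (measurable_signsOn T h.measurable)
    (S := {p : X × (T → ℝ) | t * √(∑ i, ‖c p.1 i‖ ^ 2) < ‖∑ i, c p.1 i * ((p.2 i : ℝ) : 𝕜)‖})
    ?_ fun x => h.measureReal_lt_norm_le (c x) ht
  have hci : ∀ i, Measurable fun p : X × (T → ℝ) => c p.1 i := fun i =>
    (measurable_pi_apply i).comp (hc.comp measurable_fst)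
  have hsi : ∀ i, Measurable fun p : X × (T → ℝ) => ((p.2 i : ℝ) : 𝕜) := fun i =>
    RCLike.continuous_ofReal.measurable.comp ((measurable_pi_apply i).comp measurable_snd)
  refine measurableSet_lt ?_ ?_
  · exact ((Finset.measurable_sum _ fun i _ => ((hci i).norm.pow_const 2)).sqrt).const_mul _
  · exact (Finset.measurable_sum _ fun i _ => (hci i).mul (hsi i)).norm

theorem measureReal_exists_le {Ω ι : Type*} [MeasurableSpace Ω] {P : Measure Ω}
    [IsFiniteMeasure P] (s : Finset ι) {p : ι → Ω → Prop} {ε : ℝ}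
    (h : ∀ i ∈ s, P.real {ω | p i ω} ≤ ε) : P.real {ω | ∃ i ∈ s, p i ω} ≤ s.card * ε := by
  have e : {ω | ∃ i ∈ s, p i ω} = ⋃ i ∈ s, {ω | p i ω} := by
    ext ω; simp
  rw [e, ← nsmul_eq_mul]
  exact (measureReal_biUnion_finset_le s _).trans (Finset.sum_le_card_nsmul _ _ _ h)

theorem measurable_restrictTo {X : Type*} [MeasurableSpace X] (T : Finset (Fin n))
    {u : X → Fin n → 𝕜} (hu : Measurable u) : Measurable fun x => restrictTo T (u x) := by
  refine measurable_pi_lambda _ fun j => ?_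
  unfold restrictTo
  split_ifs
  · exact (measurable_pi_apply j).comp hu
  · exact measurable_const

theorem measurable_golfedRow (T : Finset (Fin n)) (J : ℕ → Finset (Fin m)) (k : ℕ) (i : Fin m) :
    Measurable fun a : Fin m → Fin n → 𝕜 => golfedRow T J a k i :=
  measurable_golf T J _ measurable_id (measurable_restrictTo T (measurable_pi_apply i))

theorem golf_congr {T : Finset (Fin n)} {J : ℕ → Finset (Fin m)} {a b : Fin m → Fin n → 𝕜}
    {l : List ℕ} (h : ∀ k ∈ l, ∀ i ∈ J k, a i = b i) (u : Fin n → 𝕜) :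
    golf T J a l u = golf T J b l u := by
  induction l generalizing u with
  | nil => rfl
  | cons k l ih =>
    have e : golfStep T (J k) a u = golfStep T (J k) b u := by
      funext j
      simp only [golfStep, gram_congr (h k (by simp)) u]
    rw [golf_cons, golf_cons, e, ih fun k' hk' => h k' (by simp [hk'])]

variable {ν : Measure (Fin n → 𝕜)} {μ : ℝ}

/-- The rows are good with high probability. The bounds are union bounds over coordinates, batches
and rows. -/
theorem IsSensingLaw.measureReal_not_goodRows_le (h : IsSensingLaw ν μ) (T : Finset (Fin n))
    {B : Finset (Fin m)} (hm : 0 < m) {J : ℕ → Finset (Fin m)} {κ : ℕ → ℝ} {K : ℕ} {ε : ℝ}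
    (hJ : Pairwise fun k k' => Disjoint (J k) (J k')) (hJB : ∀ k, Disjoint (J k) B)
    (hκ : ∀ k, 0 < κ k ∧ κ k ≤ 1) (hJne : ∀ k < K, (J k).Nonempty)
    (hε : ∀ k < K, 4 * Real.exp (-(κ k ^ 2 * (J k).card / (8 * μ * T.card))) ≤ ε)
    (hεB : 4 * Real.exp (-(m / (8 * μ * T.card))) ≤ ε) (hε0 : 0 ≤ ε) :
    (Measure.pi fun _ : Fin m => ν).real {a | ¬ GoodRows T B J κ K μ a} ≤
      T.card * (K * (n * ε)) + K * (m * (K * (n * ε))) + K * (m * (n * ε)) := by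
  have := h.isProbabilityMeasure
  have hm0 : (0 : ℝ) < m := by exact_mod_cast hm
  have hbd : (Measure.pi fun _ : Fin m => ν).real {a | ¬ ∀ i j, ‖a i j‖ ≤ √μ} = 0 := by
    have : ∀ᵐ a ∂(Measure.pi fun _ : Fin m => ν), ∀ i j, ‖a i j‖ ≤ √μ := by
      rw [ae_all_iff]
      intro i
      exact (measurePreserving_eval (fun _ : Fin m => ν) i).quasiMeasurePreserving.ae h.bounded
    rw [measureReal_def, ae_iff.1 this, ENNReal.toReal_zero]
  have hsingle : (Measure.pi fun _ : Fin m => ν).real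
      {a | ∃ j ∈ T, ¬ GolfGood T J κ a (List.range K) (Pi.single j 1)} ≤
      T.card * (K * (n * ε)) := by
    refine measureReal_exists_le T fun j hj => ?_
    have := h.measureReal_not_golfGood_le T J (κ := κ) (ε := ε) (List.range K)
      (List.nodup_range.imp fun hne => hJ hne) (fun k _ => hκ k)
      (fun k hk => hJne k (List.mem_range.1 hk)) (fun k hk => hε k (List.mem_range.1 hk))
      (Z := fun _ => Pi.single j 1) measurable_const
      (fun _ l hl => Pi.single_eq_of_ne (fun e => hl (by rw [e]; exact hj)) _)
      (fun _ _ _ _ _ => rfl)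
    rwa [List.length_range] at this
  have hrow : (Measure.pi fun _ : Fin m => ν).real
      {a | ∃ k ∈ Finset.range K, ∃ i ∈ J k,
        ¬ GolfGood T J κ a (List.range k).reverse (restrictTo T (a i))} ≤
      K * (m * (K * (n * ε))) := by
    have h1 := measureReal_exists_le (P := Measure.pi fun _ : Fin m => ν) (Finset.range K)
      (p := fun k a => ∃ i ∈ J k, ¬ GolfGood T J κ a (List.range k).reverse (restrictTo T (a i)))
      (ε := m * (K * (n * ε))) ?_
    · rwa [Finset.card_range] at h1
    intro k hk
    have hk' := Finset.mem_range.1 hk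
    refine (measureReal_exists_le (J k) (ε := K * (n * ε)) fun i hi => ?_).trans ?_
    · have h2 := h.measureReal_not_golfGood_le T J (κ := κ) (ε := ε) (List.range k).reverse
        (List.pairwise_reverse.2 (List.nodup_range.imp fun hne => hJ hne.symm))
        (fun l _ => hκ l)
        (fun l hl => hJne l ((List.mem_range.1 (List.mem_reverse.1 hl)).trans hk'))
        (fun l hl => hε l ((List.mem_range.1 (List.mem_reverse.1 hl)).trans hk'))
        (Z := fun a => restrictTo T (a i)) (measurable_restrictTo T (measurable_pi_apply i))
        (fun _ l hl => restrictTo_support hl)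
        (fun l hl a b hab => by
          have hlk := List.mem_range.1 (List.mem_reverse.1 hl)
          rw [hab i (Finset.disjoint_left.1 (hJ hlk.ne') hi)])
      refine h2.trans ?_
      rw [List.length_reverse, List.length_range]
      exact mul_le_mul_of_nonneg_right (by exact_mod_cast hk'.le) (by positivity)
    · refine mul_le_mul_of_nonneg_right ?_ (by positivity)
      exact_mod_cast (Finset.card_le_univ _).trans_eq (Fintype.card_fin m)
  have hgram : (Measure.pi fun _ : Fin m => ν).real
      {a | ∃ k ∈ Finset.range K, ∃ i ∈ J k, ¬ ∀ j, ‖gram m B a (golfedRow T J a k i) j -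
        ((B.card / m : ℝ) : 𝕜) * golfedRow T J a k i j‖ ≤ 1 * ‖golfedRow T J a k i‖} ≤
      K * (m * (n * ε)) := by
    have h1 := measureReal_exists_le (P := Measure.pi fun _ : Fin m => ν) (Finset.range K)
      (p := fun k a => ∃ i ∈ J k, ¬ ∀ j, ‖gram m B a (golfedRow T J a k i) j -
        ((B.card / m : ℝ) : 𝕜) * golfedRow T J a k i j‖ ≤ 1 * ‖golfedRow T J a k i‖)
      (ε := m * (n * ε)) ?_
    · rwa [Finset.card_range] at h1
    intro k hk
    refine (measureReal_exists_le (J k) (ε := n * ε) fun i hi => ?_).trans ?_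
    · refine (h.measureReal_gram_of_indep T B (N := m) (κ := 1)
        (by exact_mod_cast (Finset.card_le_univ _).trans_eq (Fintype.card_fin m)) hm0
        one_pos le_rfl (measurable_golfedRow T J k i) (fun _ => golfedRow_support) ?_).trans ?_
      · intro a b hab
        have hJab : ∀ l, ∀ i' ∈ J l, a i' = b i' := fun l i' hi' =>
          hab i' (Finset.disjoint_left.1 (hJB l) hi')
        change golf T J a _ (restrictTo T (a i)) = golf T J b _ (restrictTo T (b i))
        rw [hJab k i hi, golf_congr fun l _ => hJab l]
      · rw [one_pow, one_mul]
        exact mul_le_mul_of_nonneg_left hεB (Nat.cast_nonneg _)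
    · refine mul_le_mul_of_nonneg_right ?_ (by positivity)
      exact_mod_cast (Finset.card_le_univ _).trans_eq (Fintype.card_fin m)
  have hsub : {a | ¬ GoodRows T B J κ K μ a} ⊆
      (({a | ¬ ∀ i j, ‖a i j‖ ≤ √μ} ∪
        {a | ∃ j ∈ T, ¬ GolfGood T J κ a (List.range K) (Pi.single j 1)}) ∪
        {a | ∃ k ∈ Finset.range K, ∃ i ∈ J k,
          ¬ GolfGood T J κ a (List.range k).reverse (restrictTo T (a i))}) ∪
        {a | ∃ k ∈ Finset.range K, ∃ i ∈ J k, ¬ ∀ j, ‖gram m B a (golfedRow T J a k i) j -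
          ((B.card / m : ℝ) : 𝕜) * golfedRow T J a k i j‖ ≤ 1 * ‖golfedRow T J a k i‖} := by
    intro a ha
    by_contra hcon
    simp only [Set.mem_union, not_or] at hcon
    obtain ⟨⟨⟨c1, c2⟩, c3⟩, c4⟩ := hcon
    simp only [Set.mem_ofPred_eq, not_exists, not_and, not_not] at c1 c2 c3 c4
    exact ha ⟨c1, c2, fun k hk => c3 k (Finset.mem_range.2 hk),
      fun k hk => c4 k (Finset.mem_range.2 hk)⟩
  refine (measureReal_mono hsub).trans ?_
  refine (measureReal_union_le _ _).trans (add_le_add ?_ hgram)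
  refine (measureReal_union_le _ _).trans (add_le_add ?_ hrow)
  refine (measureReal_union_le _ _).trans ?_
  rw [hbd, zero_add]
  exact hsingle

/-- The extension of a family indexed by `T` by zero. -/
def extendZero {ι : Type*} [DecidableEq ι] (T : Finset ι) (s : T → ℝ) : ι → ℝ :=
  fun j => if h : j ∈ T then s ⟨j, h⟩ else 0

theorem extendZero_coe {ι : Type*} [DecidableEq ι] {T : Finset ι} (s : T → ℝ) (i : T) :
    extendZero T s i = s i := by
  simp [extendZero]

theorem extendZero_of_notMem {ι : Type*} [DecidableEq ι] {T : Finset ι} (s : T → ℝ) {j : ι}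
    (hj : j ∉ T) : extendZero T s j = 0 := dif_neg hj

theorem measurable_extendZero {ι : Type*} [DecidableEq ι] (T : Finset ι) (j : ι) :
    Measurable fun s : T → ℝ => extendZero T s j := by
  unfold extendZero
  split_ifs
  · exact measurable_pi_apply _
  · exact measurable_const

/-- Hoeffding's inequality with independent random coefficients, for signs extended by zero. -/
theorem HasRandomSigns.measureReal_not_norm_le {Ω ι X : Type*} [DecidableEq ι] [MeasurableSpace Ω]
    [MeasurableSpace X] {P : Measure Ω} [IsProbabilityMeasure P] {T : Finset ι} {z : Ω → ι → ℝ}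
    (h : HasRandomSigns P T z) {a : Ω → X} (ha : Measurable a)
    (hind : IndepFun a (fun ω => signsOn T (z ω)) P) {c : X → ι → 𝕜}
    (hc : ∀ i, Measurable fun x => c x i) {t : ℝ} (ht : 0 ≤ t) :
    P.real {ω | ¬ ‖∑ i ∈ T, c (a ω) i * ((extendZero T (signsOn T (z ω)) i : ℝ) : 𝕜)‖ ≤
      t * √(∑ i ∈ T, ‖c (a ω) i‖ ^ 2)} ≤ 4 * Real.exp (-t ^ 2 / 4) := by
  have h1 := h.measureReal_lt_norm_le_of_indepFun (𝕜 := 𝕜) ha hind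
    (c := fun x (i : T) => c x i) (measurable_pi_lambda _ fun i => hc i) ht
  refine le_trans (le_of_eq ?_) h1
  congr 1
  ext ω
  simp only [Set.mem_ofPred_eq, not_le]
  rw [← Finset.sum_coe_sort T, ← Finset.sum_coe_sort T]
  simp only [extendZero_coe]

theorem measureReal_not_goodSigns_le {Ω : Type*} [MeasurableSpace Ω] {P : Measure Ω}
    [IsProbabilityMeasure P] {T : Finset (Fin n)} {B : Finset (Fin m)} {a : Ω → Fin m → Fin n → 𝕜}
    {x : Ω → Fin n → ℝ} {f : Ω → Fin m → ℝ} (ha : Measurable a)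
    (hx : HasRandomSigns P T x) (hf : HasRandomSigns P B f)
    (hax : IndepFun a (fun ω => signsOn T (x ω)) P)
    (haf : IndepFun a (fun ω => signsOn B (f ω)) P) (J : ℕ → Finset (Fin m)) (K : ℕ) {t ε : ℝ}
    (ht : 0 ≤ t) (hε : 4 * Real.exp (-t ^ 2 / 4) ≤ ε) (hε0 : 0 ≤ ε) :
    P.real {ω | ¬ GoodSigns T B J K t (a ω) (extendZero T (signsOn T (x ω)))
      (extendZero B (signsOn B (f ω)))} ≤ K * (m * ε) + K * (m * ε) + n * ε := by
  have hKm : ∀ p : ℕ → Fin m → Ω → Prop, (∀ k i, P.real {ω | p k i ω} ≤ ε) →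
      P.real {ω | ∃ k ∈ Finset.range K, ∃ i ∈ J k, p k i ω} ≤ K * (m * ε) := by
    intro p hp
    have h1 := measureReal_exists_le (P := P) (Finset.range K)
      (p := fun k ω => ∃ i ∈ J k, p k i ω) (ε := m * ε) fun k _ => ?_
    · rwa [Finset.card_range] at h1
    · refine (measureReal_exists_le (J k) fun i _ => hp k i).trans
        (mul_le_mul_of_nonneg_right ?_ hε0)
      exact_mod_cast (Finset.card_le_univ _).trans_eq (Fintype.card_fin m)
  have h1 := hKm (fun k i ω => ¬ ‖∑ j ∈ T, star (golfedRow T J (a ω) k i j) *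
      ((extendZero T (signsOn T (x ω)) j : ℝ) : 𝕜)‖ ≤
      t * √(∑ j ∈ T, ‖star (golfedRow T J (a ω) k i j)‖ ^ 2)) fun k i => by
    refine (hx.measureReal_not_norm_le ha hax (𝕜 := 𝕜)
      (c := fun a j => star (golfedRow T J a k i j)) (fun j => ?_) ht).trans hε
    exact continuous_star.measurable.comp
      ((measurable_pi_apply j).comp (measurable_golfedRow T J k i))
  have h2 := hKm (fun k i ω => ¬ ‖∑ i' ∈ B, herm (golfedRow T J (a ω) k i) (a ω i') /
      ((√(m : ℝ) : ℝ) : 𝕜) * ((extendZero B (signsOn B (f ω)) i' : ℝ) : 𝕜)‖ ≤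
      t * √(∑ i' ∈ B, ‖herm (golfedRow T J (a ω) k i) (a ω i') / ((√(m : ℝ) : ℝ) : 𝕜)‖ ^ 2))
    fun k i => by
      refine (hf.measureReal_not_norm_le ha haf (𝕜 := 𝕜)
        (c := fun a i' => herm (golfedRow T J a k i) (a i') / ((√(m : ℝ) : ℝ) : 𝕜))
        (fun i' => ?_) ht).trans hε
      exact (continuous_herm.measurable.comp
        ((measurable_golfedRow T J k i).prodMk (measurable_pi_apply i'))).div_const _
  have h3 := measureReal_exists_le (P := P) (Finset.univ : Finset (Fin n))
    (p := fun j ω => ¬ ‖∑ i ∈ B, a ω i j / ((√(m : ℝ) : ℝ) : 𝕜) *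
      ((extendZero B (signsOn B (f ω)) i : ℝ) : 𝕜)‖ ≤
      t * √(∑ i ∈ B, ‖a ω i j / ((√(m : ℝ) : ℝ) : 𝕜)‖ ^ 2)) (ε := ε) fun j _ => by
    refine (hf.measureReal_not_norm_le ha haf (𝕜 := 𝕜)
      (c := fun a i => a i j / ((√(m : ℝ) : ℝ) : 𝕜)) (fun i => ?_) ht).trans hε
    exact ((measurable_pi_apply j).comp (measurable_pi_apply i)).div_const _
  rw [Finset.card_univ, Fintype.card_fin] at h3
  refine le_trans (measureReal_mono ?_) ((measureReal_union_le _ _).trans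
    (add_le_add ((measureReal_union_le _ _).trans (add_le_add h1 h2)) h3))
  intro ω hω
  by_contra hcon
  simp only [Set.mem_union, not_or] at hcon
  obtain ⟨⟨c1, c2⟩, c3⟩ := hcon
  simp only [Set.mem_ofPred_eq, not_exists, not_and, not_not] at c1 c2 c3
  exact hω ⟨fun k hk => c1 k (Finset.mem_range.2 hk), fun k hk => c2 k (Finset.mem_range.2 hk),
    fun j => c3 j (Finset.mem_univ j)⟩

theorem measurable_golfStart {X : Type*} [MeasurableSpace X] (T : Finset (Fin n)) (lam : ℝ)
    {a : X → Fin m → Fin n → 𝕜} {σ : X → Fin n → ℝ} {φ : X → Fin m → ℝ} (ha : Measurable a)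
    (hσ : Measurable σ) (hφ : Measurable φ) :
    Measurable fun p => golfStart T lam (a p) (σ p) (φ p) := by
  have hcont : Continuous fun p : (Fin m → Fin n → 𝕜) × (Fin n → ℝ) × (Fin m → ℝ) =>
      fun j => (p.2.1 j : 𝕜) - lam * sensingAdjoint p.1 (fun i => (p.2.2 i : 𝕜)) j := by
    unfold sensingAdjoint
    simp only [div_eq_mul_inv]
    fun_prop
  exact measurable_restrictTo T (hcont.measurable.comp (ha.prodMk (hσ.prodMk hφ)))

/-- Golfing from the sign pattern succeeds with high probability: the starting vector involves
the corrupted rows only, which do not enter the batches. -/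
theorem IsSensingLaw.measureReal_not_golfGood_start_le (h : IsSensingLaw ν μ) {Ω : Type*}
    [MeasurableSpace Ω] {P : Measure Ω} [IsProbabilityMeasure P] {T : Finset (Fin n)}
    {B : Finset (Fin m)} {a : Ω → Fin m → Fin n → 𝕜} {x : Ω → Fin n → ℝ} {f : Ω → Fin m → ℝ}
    (ha : Measurable a) (hlaw : P.map a = Measure.pi fun _ => ν)
    (hx : HasRandomSigns P T x) (hf : HasRandomSigns P B f)
    (hind : IndepFun a (fun ω => (signsOn T (x ω), signsOn B (f ω))) P) (lam : ℝ)
    {J : ℕ → Finset (Fin m)} {κ : ℕ → ℝ} {K : ℕ} {ε : ℝ}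
    (hJ : Pairwise fun k k' => Disjoint (J k) (J k')) (hJB : ∀ k, Disjoint (J k) B)
    (hκ : ∀ k, 0 < κ k ∧ κ k ≤ 1) (hJne : ∀ k < K, (J k).Nonempty)
    (hε : ∀ k < K, 4 * Real.exp (-(κ k ^ 2 * (J k).card / (8 * μ * T.card))) ≤ ε) :
    P.real {ω | ¬ GolfGood T J κ (a ω) (List.range K) (golfStart T lam (a ω)
      (extendZero T (signsOn T (x ω))) (extendZero B (signsOn B (f ω))))} ≤ K * (n * ε) := by
  have hS : Measurable fun p : ((T → ℝ) × (B → ℝ)) × (Fin m → Fin n → 𝕜) =>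
      golfStart T lam p.2 (extendZero T p.1.1) (extendZero B p.1.2) :=
    measurable_golfStart T lam measurable_snd
      (measurable_pi_lambda _ fun j =>
        (measurable_extendZero T j).comp (measurable_fst.comp measurable_fst))
      (measurable_pi_lambda _ fun i =>
        (measurable_extendZero B i).comp (measurable_snd.comp measurable_fst))
  refine IndepFun.measureReal_le_of_slice hind.symm
    ((measurable_signsOn T hx.measurable).prodMk (measurable_signsOn B hf.measurable)) ha
    (S := {p | ¬ GolfGood T J κ p.2 (List.range K)
      (golfStart T lam p.2 (extendZero T p.1.1) (extendZero B p.1.2))})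
    (measurableSet_golfGood T J κ _ measurable_snd hS).compl fun s => ?_
  have hZ : Measurable fun a : Fin m → Fin n → 𝕜 =>
      golfStart T lam a (extendZero T s.1) (extendZero B s.2) :=
    hS.comp (measurable_const.prodMk measurable_id)
  have h1 := h.measureReal_not_golfGood_le T J (κ := κ) (ε := ε) (List.range K)
    (List.nodup_range.imp fun hne => hJ hne) (fun k _ => hκ k)
    (fun k hk => hJne k (List.mem_range.1 hk)) (fun k hk => hε k (List.mem_range.1 hk)) hZ
    (fun _ j hj => restrictTo_support hj) (fun k _ a b hab => by
      funext j
      have e : sensingAdjoint a (fun i => ((extendZero B s.2 i : ℝ) : 𝕜)) =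
          sensingAdjoint b (fun i => ((extendZero B s.2 i : ℝ) : 𝕜)) := by
        funext j
        rw [sensingAdjoint_eq_sum fun i hi => extendZero_of_notMem _ hi,
          sensingAdjoint_eq_sum fun i hi => extendZero_of_notMem _ hi]
        exact Finset.sum_congr rfl fun i hi => by
          rw [hab i (Finset.disjoint_right.1 (hJB k) hi)]
      rw [golfStart, golfStart, e])
  have hmeas : MeasurableSet {a : Fin m → Fin n → 𝕜 | ¬ GolfGood T J κ a (List.range K)
      (golfStart T lam a (extendZero T s.1) (extendZero B s.2))} :=
    (measurableSet_golfGood T J κ _ measurable_id hZ).compl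
  rw [List.length_range, ← hlaw, map_measureReal_apply ha hmeas] at h1
  exact h1

end Probability

/-! ### Batch sizes and contraction factors -/

theorem exists_disjoint_batches {α : Type*} [DecidableEq α] (S : Finset α) (c : ℕ → ℕ) (K : ℕ)
    (h : ∑ k ∈ Finset.range K, c k ≤ S.card) :
    ∃ J : ℕ → Finset α, (Pairwise fun k k' => Disjoint (J k) (J k')) ∧ (∀ k, J k ⊆ S) ∧
      ∀ k < K, (J k).card = c k := by
  suffices H : ∃ J : ℕ → Finset α, (Pairwise fun k k' => Disjoint (J k) (J k')) ∧
      (∀ k, J k ⊆ S) ∧ (∀ k < K, (J k).card = c k) ∧ ∀ k, K ≤ k → J k = ∅ by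
    obtain ⟨J, h1, h2, h3, -⟩ := H
    exact ⟨J, h1, h2, h3⟩
  induction K with
  | zero => exact ⟨fun _ => ∅, fun _ _ _ => by simp, by simp, by simp, by simp⟩
  | succ K ih =>
    rw [Finset.sum_range_succ] at h
    obtain ⟨J, h1, h2, h3, h4⟩ := ih (by omega)
    have hU : ((Finset.range K).biUnion J).card ≤ ∑ k ∈ Finset.range K, c k :=
      Finset.card_biUnion_le.trans
        (Finset.sum_le_sum fun k hk => (h3 k (Finset.mem_range.1 hk)).le)
    obtain ⟨R, hR, hRc⟩ := Finset.exists_subset_card_eq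
      (s := S \ (Finset.range K).biUnion J) (n := c K) (by
        have := Finset.le_card_sdiff ((Finset.range K).biUnion J) S
        omega)
    have hRd : ∀ k, Disjoint R (J k) := by
      intro k
      by_cases hk : k < K
      · rw [Finset.disjoint_left]
        intro i hi hik
        exact (Finset.mem_sdiff.1 (hR hi)).2
          (Finset.mem_biUnion.2 ⟨k, Finset.mem_range.2 hk, hik⟩)
      · rw [h4 k (not_lt.1 hk)]; simp
    refine ⟨Function.update J K R, ?_, ?_, ?_, ?_⟩
    · intro k k' hne
      rcases eq_or_ne k K with rfl | hk
      · rw [Function.update_self, Function.update_of_ne hne.symm]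
        exact hRd k'
      · rw [Function.update_of_ne hk]
        rcases eq_or_ne k' K with rfl | hk'
        · rw [Function.update_self]; exact (hRd k).symm
        · rw [Function.update_of_ne hk']; exact h1 hne
    · intro k
      rcases eq_or_ne k K with rfl | hk
      · rw [Function.update_self]; exact hR.trans Finset.sdiff_subset
      · rw [Function.update_of_ne hk]; exact h2 k
    · intro k hk
      rcases eq_or_ne k K with rfl | hne
      · rw [Function.update_self]; exact hRc
      · rw [Function.update_of_ne hne]; exact h3 k (by omega)
    · intro k hk
      rw [Function.update_of_ne (by omega)]; exact h4 k (by omega)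

/-- The sizes of the golfing batches: two batches take up a constant fraction of the rows, the
others share another such fraction. -/
def batchSize (m L k : ℕ) : ℕ := if k < 2 then m / 8 else m / (4 * L)

/-- The contraction factors of the golfing steps, where `ℓ` stands for `log n`. The first two
steps gain a factor `ℓ`, which pays for the smallness of the later batches. -/
noncomputable def golfRate (ℓ : ℝ) (k : ℕ) : ℝ := if k < 2 then 1 / (16 * √ℓ) else 1 / 4

theorem sum_batchSize_le (m L : ℕ) :
    2 * ∑ k ∈ Finset.range (L + 2), batchSize m L k ≤ m := by
  rw [Finset.sum_range_succ', Finset.sum_range_succ']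
  have e : ∑ k ∈ Finset.range L, batchSize m L (k + 1 + 1) = L * (m / (4 * L)) := by
    rw [Finset.sum_congr rfl fun k _ => show batchSize m L (k + 1 + 1) = m / (4 * L) from
      if_neg (by omega), Finset.sum_const, Finset.card_range, smul_eq_mul]
  have h1 : 4 * L * (m / (4 * L)) ≤ m := Nat.mul_div_le _ _
  have e0 : batchSize m L 0 = m / 8 := if_pos (by omega)
  have e1 : batchSize m L (0 + 1) = m / 8 := if_pos (by omega)
  have h2 : 4 * (L * (m / (4 * L))) ≤ m := by rwa [← mul_assoc]
  rw [e, e0, e1]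
  omega

theorem le_two_mul_cast_div {m d : ℕ} (hd : 0 < d) (h : d ≤ m) :
    (m : ℝ) ≤ 2 * d * ((m / d : ℕ) : ℝ) := by
  have h1 : m < d * (m / d + 1) := Nat.lt_mul_div_succ m hd
  have h2 : 1 ≤ m / d := Nat.div_pos h hd
  have h3 : m ≤ 2 * d * (m / d) := by nlinarith
  exact_mod_cast h3

theorem golfRate_pos {ℓ : ℝ} (hℓ : 1 ≤ ℓ) (k : ℕ) : 0 < golfRate ℓ k := by
  unfold golfRate
  split_ifs <;> positivity

theorem golfRate_le {ℓ : ℝ} (hℓ : 1 ≤ ℓ) (k : ℕ) : golfRate ℓ k ≤ 1 / 4 := by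
  have : 1 ≤ √ℓ := Real.one_le_sqrt.2 hℓ
  unfold golfRate
  split_ifs
  · exact one_div_le_one_div_of_le (by norm_num) (by linarith)
  · exact le_rfl

theorem prod_golfRate_nonneg {ℓ : ℝ} (hℓ : 1 ≤ ℓ) (k : ℕ) :
    0 ≤ ∏ i ∈ Finset.range k, golfRate ℓ i :=
  Finset.prod_nonneg fun i _ => (golfRate_pos hℓ i).le

theorem prod_golfRate_le_pow {ℓ : ℝ} (hℓ : 1 ≤ ℓ) (k : ℕ) :
    ∏ i ∈ Finset.range k, golfRate ℓ i ≤ (1 / 4) ^ k := by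
  refine (Finset.prod_le_prod (fun i _ => (golfRate_pos hℓ i).le)
    fun i _ => golfRate_le hℓ i).trans_eq ?_
  rw [Finset.prod_const, Finset.card_range]

theorem prod_golfRate_le_one {ℓ : ℝ} (hℓ : 1 ≤ ℓ) (k : ℕ) :
    ∏ i ∈ Finset.range k, golfRate ℓ i ≤ 1 :=
  (prod_golfRate_le_pow hℓ k).trans (pow_le_one₀ (by norm_num) (by norm_num))

theorem sum_prod_golfRate_le {ℓ : ℝ} (hℓ : 1 ≤ ℓ) (K : ℕ) :
    ∑ k ∈ Finset.range K, ∏ i ∈ Finset.range (k + 1), golfRate ℓ i ≤ 1 / 8 := by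
  have h0 : golfRate ℓ 0 ≤ 1 / 16 := by
    have : 1 ≤ √ℓ := Real.one_le_sqrt.2 hℓ
    rw [golfRate, if_pos (by norm_num)]
    exact one_div_le_one_div_of_le (by norm_num) (by linarith)
  have h1 : ∀ k, ∏ i ∈ Finset.range (k + 1), golfRate ℓ i ≤ 1 / 16 * (1 / 2) ^ k := by
    intro k
    rw [Finset.prod_range_succ', mul_comm]
    refine mul_le_mul h0 ?_ (Finset.prod_nonneg fun i _ => (golfRate_pos hℓ _).le) (by norm_num)
    refine (Finset.prod_le_prod (fun i _ => (golfRate_pos hℓ _).le)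
      fun i _ => (golfRate_le hℓ (i + 1)).trans (show (1 / 4 : ℝ) ≤ 1 / 2 by norm_num)).trans_eq ?_
    rw [Finset.prod_const, Finset.card_range]
  refine (Finset.sum_le_sum fun k _ => h1 k).trans ?_
  rw [← Finset.mul_sum]
  have := sum_geometric_two_le K
  linarith

theorem prod_golfRate_le_of_two_le {ℓ : ℝ} (hℓ : 1 ≤ ℓ) {k : ℕ} (hk : 2 ≤ k) :
    ∏ i ∈ Finset.range k, golfRate ℓ i ≤ 1 / (256 * ℓ) := by
  obtain ⟨k, rfl⟩ := Nat.exists_eq_add_of_le hk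
  rw [Finset.prod_range_add]
  have h2 : ∏ i ∈ Finset.range 2, golfRate ℓ i = 1 / (256 * ℓ) := by
    rw [Finset.prod_range_succ, Finset.prod_range_one, golfRate, golfRate, if_pos (by norm_num),
      if_pos (by norm_num), div_mul_div_comm, mul_mul_mul_comm, Real.mul_self_sqrt (by linarith)]
    norm_num
  rw [h2]
  refine mul_le_of_le_one_right (by positivity) (Finset.prod_le_one
    (fun i _ => (golfRate_pos hℓ _).le) fun i _ => (golfRate_le hℓ _).trans (by norm_num))

/-- The batch sizes in comparison with `m`. -/
theorem le_mul_batchSize {ℓ : ℝ} (hℓ : 1 ≤ ℓ) {m L : ℕ} (hL0 : 0 < L) (hL : (L : ℝ) ≤ 9 * ℓ)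
    (hm : 36 * ℓ ≤ m) (k : ℕ) :
    (m : ℝ) ≤ (if k < 2 then 16 else 72 * ℓ) * batchSize m L k := by
  have h4L : 4 * L ≤ m := by
    have : (4 * L : ℝ) ≤ m := by linarith
    exact_mod_cast this
  have h8 : 8 ≤ m := by
    have : (8 : ℝ) ≤ m := by linarith
    exact_mod_cast this
  unfold batchSize
  split_ifs
  · have := le_two_mul_cast_div (show 0 < 8 by norm_num) h8
    norm_num at this ⊢
    exact this
  · refine (le_two_mul_cast_div (by omega) h4L).trans
      (mul_le_mul_of_nonneg_right ?_ (Nat.cast_nonneg _))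
    push_cast
    linarith

/-- The batches are large enough for Bernstein's inequality at the given contraction factors. -/
theorem le_golfRate_sq_mul_batchSize {ℓ q : ℝ} (hℓ : 1 ≤ ℓ) {m L : ℕ} (hL0 : 0 < L)
    (hL : (L : ℝ) ≤ 9 * ℓ) (hq : 1 ≤ q) (hm : 2 ^ 20 * (q * ℓ ^ 2) ≤ m) (k : ℕ) :
    64 * q * ℓ ≤ golfRate ℓ k ^ 2 * batchSize m L k := by
  have hℓ2 : ℓ ≤ q * ℓ ^ 2 := by nlinarith [mul_le_mul hq hℓ (by norm_num) (by linarith)]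
  have h1 := le_mul_batchSize hℓ hL0 hL (by nlinarith) k
  by_cases hk : k < 2
  · rw [if_pos hk] at h1
    have e : golfRate ℓ k ^ 2 = 1 / (256 * ℓ) := by
      rw [golfRate, if_pos hk, div_pow, mul_pow, Real.sq_sqrt (by linarith)]
      norm_num
    rw [e, div_mul_eq_mul_div, le_div_iff₀ (by positivity), one_mul]
    nlinarith
  · rw [if_neg hk] at h1
    rw [golfRate, if_neg hk]
    have h2 : ℓ * (2 ^ 20 * (q * ℓ)) ≤ ℓ * (72 * batchSize m L k) := by nlinarith
    have h3 := le_of_mul_le_mul_left h2 (by linarith)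
    have : 0 ≤ q * ℓ := by positivity
    linarith

/-- The entries of the golfing dual vector are small compared with `λ = 1 / √ℓ`. -/
theorem golf_entry_le {ℓ q : ℝ} (hℓ : 1 ≤ ℓ) {m L : ℕ} (hL0 : 0 < L)
    (hL : (L : ℝ) ≤ 9 * ℓ) (hq : 1 ≤ q) (hm : 2 ^ 20 * (q * ℓ ^ 2) ≤ m) (k : ℕ) :
    √(m : ℝ) / batchSize m L k * (3 * √(32 * ℓ) * √q * ∏ l ∈ Finset.range k, golfRate ℓ l) ≤
      1 / √ℓ / 2 := by
  have hℓ2 : ℓ ≤ q * ℓ ^ 2 := by nlinarith [mul_le_mul hq hℓ (by norm_num) (by linarith)]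
  have h1 := le_mul_batchSize hℓ hL0 hL (by nlinarith) k
  have hm0 : (0 : ℝ) < m := by nlinarith
  have hb : (0 : ℝ) < batchSize m L k := by
    by_contra hcon
    have : (batchSize m L k : ℝ) = 0 := le_antisymm (not_lt.1 hcon) (Nat.cast_nonneg _)
    rw [this, mul_zero] at h1
    linarith
  have hsℓ : 0 < √ℓ := Real.sqrt_pos.2 (by linarith)
  -- the product of the rates compensates the size of the batch
  have h2 : (m : ℝ) * ∏ l ∈ Finset.range k, golfRate ℓ l ≤ 16 * batchSize m L k := by
    by_cases hk : k < 2
    · rw [if_pos hk] at h1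
      exact (mul_le_of_le_one_right hm0.le (prod_golfRate_le_one hℓ k)).trans h1
    · rw [if_neg hk] at h1
      refine (mul_le_mul h1 (prod_golfRate_le_of_two_le hℓ (not_lt.1 hk))
        (prod_golfRate_nonneg hℓ k) (by positivity)).trans ?_
      rw [mul_one_div, div_le_iff₀ (by positivity)]
      nlinarith [mul_pos (show (0 : ℝ) < ℓ by linarith) hb]
  have h3 : √q * (1024 * ℓ) ≤ √(m : ℝ) := by
    refine Real.le_sqrt_of_sq_le ?_
    rw [mul_pow, Real.sq_sqrt (by linarith)]
    nlinarith
  have h4 : √(32 * ℓ) ≤ 6 * √ℓ := by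
    refine Real.sqrt_le_iff.2 ⟨by positivity, ?_⟩
    rw [mul_pow, Real.sq_sqrt (by linarith)]
    linarith
  have hp := prod_golfRate_nonneg hℓ k
  set pr := ∏ l ∈ Finset.range k, golfRate ℓ l with hpr
  set b : ℝ := (batchSize m L k : ℝ) with hbdef
  rw [div_mul_eq_mul_div, div_le_iff₀ hb, div_div, div_mul_eq_mul_div, one_mul,
    le_div_iff₀ (by positivity)]
  have hss : √ℓ * √ℓ = ℓ := Real.mul_self_sqrt (by linarith)
  have hmm : √(m : ℝ) * √(m : ℝ) = m := Real.mul_self_sqrt hm0.le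
  calc √(m : ℝ) * (3 * √(32 * ℓ) * √q * pr) * (√ℓ * 2)
      ≤ √(m : ℝ) * (3 * (6 * √ℓ) * √q * pr) * (√ℓ * 2) := by gcongr
    _ = 36 / 1024 * (√(m : ℝ) * (√q * (1024 * (√ℓ * √ℓ))) * pr) := by ring
    _ ≤ 36 / 1024 * (√(m : ℝ) * √(m : ℝ) * pr) := by
        rw [hss]; gcongr
    _ = 36 / 1024 * (m * pr) := by rw [hmm]
    _ ≤ b := by linarith

/-! ### Failure probability -/

section Main

variable {𝕜 : Type*} [RCLike 𝕜] {m n : ℕ}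

theorem measureReal_not_exactRecovery_le {Ω : Type*} [MeasurableSpace Ω] {P : Measure Ω}
    [IsProbabilityMeasure P] {T : Finset (Fin n)} {B : Finset (Fin m)}
    {J : ℕ → Finset (Fin m)} {κ : ℕ → ℝ} {K : ℕ} {t μ lam p₁ p₂ p₃ : ℝ}
    {a : Ω → Fin m → Fin n → 𝕜} {x : Ω → Fin n → ℝ} {f : Ω → Fin m → ℝ}
    (hx : HasRandomSigns P T x) (hf : HasRandomSigns P B f)
    (h : ∀ (a : Fin m → Fin n → 𝕜) (x : Fin n → ℝ) (f : Fin m → ℝ), (∀ j ∉ T, x j = 0) →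
      (∀ i ∉ B, f i = 0) → GoodRows T B J κ K μ a →
      GoodSigns T B J K t a (fun j => Real.sign (x j)) (fun i => Real.sign (f i)) →
      GolfGood T J κ a (List.range K)
        (golfStart T lam a (fun j => Real.sign (x j)) (fun i => Real.sign (f i))) →
      ExactRecovery (sensingMatrix a) lam (fun j => (x j : 𝕜)) (fun i => (f i : 𝕜)))
    (h₁ : P.real {ω | ¬ GoodRows T B J κ K μ (a ω)} ≤ p₁)
    (h₂ : P.real {ω | ¬ GoodSigns T B J K t (a ω) (extendZero T (signsOn T (x ω)))
      (extendZero B (signsOn B (f ω)))} ≤ p₂)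
    (h₃ : P.real {ω | ¬ GolfGood T J κ (a ω) (List.range K) (golfStart T lam (a ω)
      (extendZero T (signsOn T (x ω))) (extendZero B (signsOn B (f ω))))} ≤ p₃) :
    P.real {ω | ¬ ExactRecovery (sensingMatrix (a ω)) lam (fun j => (x ω j : 𝕜))
      (fun i => (f ω i : 𝕜))} ≤ p₁ + p₂ + p₃ := by
  have hnull : ∀ {ι : Type} {S : Finset ι} {z : Ω → ι → ℝ}, HasRandomSigns P S z →
      P.real {ω | ¬ Function.support (z ω) = (S : Set ι)} = 0 := fun hz => by
    rw [measureReal_def, ae_iff.1 hz.support_eq, ENNReal.toReal_zero]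
  have hext : ∀ {ι : Type} [DecidableEq ι] {S : Finset ι} {z : ι → ℝ},
      Function.support z = (S : Set ι) →
      (∀ j ∉ S, z j = 0) ∧ extendZero S (signsOn S z) = fun j => Real.sign (z j) := by
    intro ι _ S z hz
    have hz0 : ∀ j ∉ S, z j = 0 := fun j hj => by
      rw [← Function.notMem_support, hz]; exact hj
    refine ⟨hz0, funext fun j => ?_⟩
    by_cases hj : j ∈ S
    · simp [extendZero, hj, signsOn]
    · rw [extendZero_of_notMem _ hj, hz0 j hj, Real.sign_zero]
  have hsub : {ω | ¬ ExactRecovery (sensingMatrix (a ω)) lam (fun j => (x ω j : 𝕜))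
      (fun i => (f ω i : 𝕜))} ⊆
      ((({ω | ¬ Function.support (x ω) = (T : Set (Fin n))} ∪
        {ω | ¬ Function.support (f ω) = (B : Set (Fin m))}) ∪
        {ω | ¬ GoodRows T B J κ K μ (a ω)}) ∪
        {ω | ¬ GoodSigns T B J K t (a ω) (extendZero T (signsOn T (x ω)))
          (extendZero B (signsOn B (f ω)))}) ∪
        {ω | ¬ GolfGood T J κ (a ω) (List.range K) (golfStart T lam (a ω)
          (extendZero T (signsOn T (x ω))) (extendZero B (signsOn B (f ω))))} := by
    intro ω hω
    by_contra hcon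
    simp only [Set.mem_union, not_or, Set.mem_ofPred_eq, not_not] at hcon
    obtain ⟨⟨⟨⟨c1, c2⟩, c3⟩, c4⟩, c5⟩ := hcon
    obtain ⟨x0, ex⟩ := hext c1
    obtain ⟨f0, ef⟩ := hext c2
    rw [ex, ef] at c4 c5
    exact hω (h _ _ _ x0 f0 c3 c4 c5)
  refine (measureReal_mono hsub).trans ?_
  refine (measureReal_union_le _ _).trans (add_le_add ?_ h₃)
  refine (measureReal_union_le _ _).trans (add_le_add ?_ h₂)
  refine (measureReal_union_le _ _).trans ?_
  have h0 := measureReal_union_le (μ := P) {ω | ¬ Function.support (x ω) = (T : Set (Fin n))}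
    {ω | ¬ Function.support (f ω) = (B : Set (Fin m))}
  rw [hnull hx, hnull hf] at h0
  linarith

theorem measureReal_comp_le_map {Ω X : Type*} [MeasurableSpace Ω] [MeasurableSpace X]
    (P : Measure Ω) [IsProbabilityMeasure P] {a : Ω → X} (ha : Measurable a) (S : Set X) :
    P.real {ω | a ω ∈ S} ≤ (P.map a).real S := by
  have := Measure.isProbabilityMeasure_map (μ := P) ha.aemeasurable
  exact ENNReal.toReal_mono (measure_ne_top _ _) (Measure.le_map_apply ha.aemeasurable S)

variable {ν : Measure (Fin n → 𝕜)} {μ : ℝ}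

/-- With empty signal support the corruption alone has to be detected, and no golfing is
needed. -/
theorem IsSensingLaw.measureReal_not_exactRecovery_le_of_empty (h : IsSensingLaw ν μ) {Ω : Type*}
    [MeasurableSpace Ω] {P : Measure Ω} [IsProbabilityMeasure P] {B : Finset (Fin m)}
    {a : Ω → Fin m → Fin n → 𝕜} {x : Ω → Fin n → ℝ} {f : Ω → Fin m → ℝ} (hm : 0 < m)
    (hμ : 1 ≤ μ) (ha : Measurable a) (hlaw : P.map a = Measure.pi fun _ => ν)
    (hx : HasRandomSigns P ∅ x) (hf : HasRandomSigns P B f)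
    (hind : IndepFun a (fun ω => (signsOn ∅ (x ω), signsOn B (f ω))) P) {t lam : ℝ} (ht : 0 ≤ t)
    (hlam : 0 < lam) (hlam1 : lam ≤ 1) (hcorr : lam * (t * √(B.card * μ / m)) ≤ 1 / 8) :
    P.real {ω | ¬ ExactRecovery (sensingMatrix (a ω)) lam (fun j => (x ω j : 𝕜))
      (fun i => (f ω i : 𝕜))} ≤ n * (4 * Real.exp (-t ^ 2 / 4)) := by
  have := h.isProbabilityMeasure
  have h2 := measureReal_not_goodSigns_le ha hx hf (hind.comp measurable_id measurable_fst)
    (hind.comp measurable_id measurable_snd) (fun _ => ∅) 0 ht le_rfl (by positivity)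
  have h1 : P.real {ω | ¬ GoodRows ∅ B (fun _ => ∅) (fun _ => 1) 0 μ (a ω)} ≤ 0 := by
    refine (measureReal_comp_le_map P ha {a | ¬ GoodRows ∅ B (fun _ => ∅) (fun _ => 1) 0 μ a}).trans
      ?_
    rw [hlaw]
    have hae : ∀ᵐ a ∂(Measure.pi fun _ : Fin m => ν),
        GoodRows ∅ B (fun _ => ∅) (fun _ => 1) 0 μ a := by
      have : ∀ᵐ a ∂(Measure.pi fun _ : Fin m => ν), ∀ i j, ‖a i j‖ ≤ √μ := by
        rw [ae_all_iff]
        intro i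
        exact (measurePreserving_eval (fun _ : Fin m => ν) i).quasiMeasurePreserving.ae h.bounded
      filter_upwards [this] with a ha
      exact ⟨ha, by simp, by simp, by simp⟩
    rw [measureReal_def, ae_iff.1 hae, ENNReal.toReal_zero]
  have h3 : P.real {ω | ¬ GolfGood ∅ (fun _ => ∅) (fun _ => 1) (a ω) (List.range 0)
      (golfStart ∅ lam (a ω) (extendZero ∅ (signsOn ∅ (x ω)))
        (extendZero B (signsOn B (f ω))))} ≤ 0 := by
    simp [GolfGood]
  refine (measureReal_not_exactRecovery_le hx hf (fun a x f hx0 hf0 hr hs hg => ?_)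
    h1 h2 h3).trans (le_of_eq (by simp))
  exact exactRecovery_of_goodSample hm hx0 hf0 hr hs hg (fun _ _ _ => by simp) (by simp)
    (fun _ => zero_le_one) (fun _ => le_rfl) ht (by linarith) hlam hlam1 hcorr (by simp)
    (by simp) (by simp) (by simpa using hlam)

/-- The numerical form of the union bound. -/
theorem union_bound_le {n s m K ε : ℝ} (hn : 3 ≤ n) (hs : s ≤ n) (hm0 : 0 ≤ m)
    (hm : m ≤ n) (hK1 : 1 ≤ K) (hK : K ≤ 11 * n) (hε0 : 0 ≤ ε) (hε : ε * n ^ 8 = 4) :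
    s * (K * (n * ε)) + K * (m * (K * (n * ε))) + K * (m * (n * ε)) +
      (K * (m * ε) + K * (m * ε) + n * ε) + K * (n * ε) ≤ 4000 * n ^ (-3 : ℤ) := by
  have hn1 : (1 : ℝ) ≤ n := by linarith
  -- every term of the union bound is at most `K² n² ε`
  have b1 : s * (K * (n * ε)) ≤ K ^ 2 * n ^ 2 * ε := by
    calc s * (K * (n * ε)) ≤ n * (K * K * (n * ε)) := by
          gcongr; exact le_mul_of_one_le_left (by linarith) hK1
      _ = _ := by ring
  have b2 : K * (m * (K * (n * ε))) ≤ K ^ 2 * n ^ 2 * ε := by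
    calc K * (m * (K * (n * ε))) ≤ K * (n * (K * (n * ε))) := by gcongr
      _ = _ := by ring
  have b3 : K * (m * (n * ε)) ≤ K ^ 2 * n ^ 2 * ε := by
    calc K * (m * (n * ε)) ≤ K * K * (n * (n * ε)) := by
          gcongr; exact le_mul_of_one_le_left (by linarith) hK1
      _ = _ := by ring
  have b4 : K * (m * ε) ≤ K ^ 2 * n ^ 2 * ε := by
    calc K * (m * ε) ≤ K * K * (n * (n * ε)) := by
          gcongr
          · exact le_mul_of_one_le_left (by linarith) hK1
          · exact le_mul_of_one_le_left hε0 hn1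
      _ = _ := by ring
  have b5 : n * ε ≤ K ^ 2 * n ^ 2 * ε := by
    have : n ≤ K ^ 2 * n ^ 2 := by nlinarith [one_le_pow₀ hK1 (n := 2)]
    exact mul_le_mul_of_nonneg_right this hε0
  have b6 : K * (n * ε) ≤ K ^ 2 * n ^ 2 * ε := by
    calc K * (n * ε) ≤ K * K * (n * (n * ε)) := by
          gcongr
          · exact le_mul_of_one_le_left (by linarith) hK1
          · exact le_mul_of_one_le_left (by positivity) hn1
      _ = _ := by ring
  have b7 : K ^ 2 * n ^ 2 * ε ≤ (11 * n) ^ 2 * n ^ 2 * ε := by gcongr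
  have b8 : (11 * n) ^ 2 * n ^ 2 * ε * n ^ 4 = 484 := by
    linear_combination 121 * hε
  have b9 : (11 * n) ^ 2 * n ^ 2 * ε = 484 * (n ^ 4)⁻¹ := by
    rw [← b8]; field_simp
  have b10 : (n ^ 4)⁻¹ ≤ n ^ (-3 : ℤ) := by
    rw [zpow_neg]
    exact inv_anti₀ (by positivity) (pow_le_pow_right₀ hn1 (by norm_num))
  have b11 : 0 ≤ n ^ (-3 : ℤ) := zpow_nonneg (by linarith) _
  linarith

theorem golf_end_lt {n s p : ℝ} (hn : 3 ≤ n) (hs : s ≤ n) (hp : 0 ≤ p) (hpn : p * n ^ 8 ≤ 1) :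
    2 * p * (2 * s) < 1 / 2 := by
  have h7 : (3 : ℝ) ^ 7 ≤ n ^ 7 := pow_le_pow_left₀ (by norm_num) hn 7
  have h1 : p * n * 3 ^ 7 ≤ 1 := by
    calc p * n * 3 ^ 7 ≤ p * n * n ^ 7 :=
          mul_le_mul_of_nonneg_left h7 (mul_nonneg hp (by linarith))
      _ = p * n ^ 8 := by ring
      _ ≤ 1 := hpn
  have h2 : p * s ≤ p * n := mul_le_mul_of_nonneg_left hs hp
  linarith

theorem golf_end_mul_lt {n s m μ ℓ p : ℝ} (hn : 3 ≤ n) (hs0 : 0 ≤ s) (hs : s ≤ n)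
    (hm : m ≤ n) (hμ : μ ≤ n) (hℓ0 : 0 < ℓ) (hℓ : ℓ ≤ n) (hp : 0 ≤ p) (hpn : p * n ^ 8 ≤ 1) :
    2 * p * (2 * s * (√m * (√μ * s))) < 1 / √ℓ / 2 := by
  have hsqrt : ∀ y ≤ n, √y ≤ n := fun y hy => Real.sqrt_le_iff.2 ⟨by linarith, by nlinarith⟩
  have e1 := hsqrt m hm
  have e2 := hsqrt μ hμ
  have e3 := hsqrt ℓ hℓ
  have hsℓ : 0 < √ℓ := Real.sqrt_pos.2 hℓ0
  have h27 : (3 : ℝ) ^ 3 ≤ n ^ 3 := pow_le_pow_left₀ (by norm_num) hn 3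
  have hn5 : 0 ≤ p * n ^ 5 := mul_nonneg hp (pow_nonneg (by linarith) 5)
  have h1 : p * n ^ 5 * 3 ^ 3 ≤ 1 := by
    calc p * n ^ 5 * 3 ^ 3 ≤ p * n ^ 5 * n ^ 3 := mul_le_mul_of_nonneg_left h27 hn5
      _ = p * n ^ 8 := by ring
      _ ≤ 1 := hpn
  rw [div_div, lt_div_iff₀ (by positivity)]
  calc 2 * p * (2 * s * (√m * (√μ * s))) * (√ℓ * 2)
      ≤ 2 * p * (2 * n * (n * (n * n))) * (n * 2) := by gcongr
    _ = 8 * (p * n ^ 5) := by ring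
    _ < 1 := by linarith

/-- The failure probability for a nonempty signal support, with explicit constants. -/
theorem IsSensingLaw.measureReal_not_exactRecovery_le_of_nonempty (h : IsSensingLaw ν μ)
    {Ω : Type*} [MeasurableSpace Ω] {P : Measure Ω} [IsProbabilityMeasure P]
    {T : Finset (Fin n)} {B : Finset (Fin m)}
    {a : Ω → Fin m → Fin n → 𝕜} {x : Ω → Fin n → ℝ} {f : Ω → Fin m → ℝ} (hm : 0 < m)
    (hmn : m < n) (hn : 3 ≤ n) (hT : T.Nonempty)
    (hμ : 1 ≤ μ) (ha : Measurable a) (hlaw : P.map a = Measure.pi fun _ => ν)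
    (hx : HasRandomSigns P T x) (hf : HasRandomSigns P B f)
    (hind : IndepFun a (fun ω => (signsOn T (x ω), signsOn B (f ω))) P)
    (hℓ : 1 ≤ Real.log n)
    (hTm : 2 ^ 20 * (T.card * μ * Real.log n ^ 2) ≤ m) (hBm : 2 * B.card ≤ m)
    (hcorr : 1 / √(Real.log n) * (√(32 * Real.log n) * √(B.card * μ / m)) ≤ 1 / 8) :
    P.real {ω | ¬ ExactRecovery (sensingMatrix (a ω)) (1 / √(Real.log n))
      (fun j => (x ω j : 𝕜)) (fun i => (f ω i : 𝕜))} ≤ 4000 * (n : ℝ) ^ (-3 : ℤ) := by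
  have := h.isProbabilityMeasure
  set ℓ := Real.log n with hℓdef
  have hs : (1 : ℝ) ≤ T.card := by exact_mod_cast hT.card_pos
  have hn0 : (3 : ℝ) ≤ n := by exact_mod_cast hn
  have hℓn : ℓ ≤ n := (Real.log_le_sub_one_of_pos (by linarith)).trans (by linarith)
  have hm1 : (1 : ℝ) ≤ m := by exact_mod_cast hm
  have hmn' : (m : ℝ) ≤ n := by exact_mod_cast hmn.le
  set q := (T.card : ℝ) * μ with hq
  have hq1 : 1 ≤ q := one_le_mul_of_one_le_of_one_le hs hμ
  have hqℓ' : q ≤ q * ℓ ^ 2 := le_mul_of_one_le_right (by linarith) (one_le_pow₀ hℓ)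
  -- the number of small batches
  set L := ⌈8 * ℓ⌉₊ with hL
  have hL8 : 8 * ℓ ≤ L := Nat.le_ceil _
  have hL9 : (L : ℝ) ≤ 9 * ℓ := by
    have := Nat.ceil_lt_add_one (show 0 ≤ 8 * ℓ by linarith)
    linarith
  have hL0 : 0 < L := Nat.ceil_pos.2 (by linarith)
  obtain ⟨J, hJ, hJB', hJc⟩ := exists_disjoint_batches (Bᶜ : Finset (Fin m)) (batchSize m L)
    (L + 2) (by
      rw [Finset.card_compl, Fintype.card_fin]
      have := sum_batchSize_le m L
      omega)
  have hJB : ∀ k, Disjoint (J k) B := fun k =>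
    Finset.disjoint_left.2 fun i hi => Finset.mem_compl.1 (hJB' k hi)
  have hκ : ∀ k, 0 < golfRate ℓ k ∧ golfRate ℓ k ≤ 1 := fun k =>
    ⟨golfRate_pos hℓ k, (golfRate_le hℓ k).trans (by norm_num)⟩
  have hbig : ∀ k, 64 * q * ℓ ≤ golfRate ℓ k ^ 2 * batchSize m L k := fun k =>
    le_golfRate_sq_mul_batchSize hℓ hL0 hL9 hq1 hTm k
  have hJne : ∀ k < L + 2, (J k).Nonempty := by
    intro k hk
    rw [← Finset.card_pos, hJc k hk]
    by_contra hcon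
    have h0 := hbig k
    rw [Nat.eq_zero_of_not_pos hcon, Nat.cast_zero, mul_zero] at h0
    nlinarith
  set ε := 4 * Real.exp (-(8 * ℓ)) with hε
  have hε0 : 0 ≤ ε := by positivity
  have hexp : ∀ k < L + 2,
      4 * Real.exp (-(golfRate ℓ k ^ 2 * (J k).card / (8 * μ * T.card))) ≤ ε := by
    intro k hk
    rw [hJc k hk]
    refine mul_le_mul_of_nonneg_left (Real.exp_le_exp.2 (neg_le_neg ?_)) (by norm_num)
    rw [le_div_iff₀ (by positivity)]
    have := hbig k
    rw [hq] at this
    linarith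
  have hexpB : 4 * Real.exp (-(m / (8 * μ * T.card))) ≤ ε := by
    refine mul_le_mul_of_nonneg_left (Real.exp_le_exp.2 (neg_le_neg ?_)) (by norm_num)
    rw [le_div_iff₀ (by positivity)]
    have h1 : q * ℓ ≤ q * ℓ ^ 2 :=
      mul_le_mul_of_nonneg_left (le_self_pow₀ hℓ two_ne_zero) (by linarith)
    have h2 : 0 ≤ q * ℓ := by positivity
    have : 8 * ℓ * (8 * μ * T.card) = 64 * (q * ℓ) := by rw [hq]; ring
    linarith
  have ht : 4 * Real.exp (-√(32 * ℓ) ^ 2 / 4) ≤ ε := by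
    rw [Real.sq_sqrt (by linarith), hε]
    exact le_of_eq (by ring_nf)
  have h1 := h.measureReal_not_goodRows_le T hm hJ hJB hκ hJne hexp hexpB hε0
  rw [← hlaw] at h1
  replace h1 := (measureReal_comp_le_map P ha
    {a | ¬ GoodRows T B J (golfRate ℓ) (L + 2) μ a}).trans h1
  have h2 := measureReal_not_goodSigns_le ha hx hf (hind.comp measurable_id measurable_fst)
    (hind.comp measurable_id measurable_snd) J (L + 2) (Real.sqrt_nonneg (32 * ℓ)) ht hε0
  have h3 := h.measureReal_not_golfGood_start_le ha hlaw hx hf hind (1 / √ℓ) hJ hJB hκ hJne hexp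
  have hsℓ : 0 < √ℓ := Real.sqrt_pos.2 (by linarith)
  have hsℓ1 : 1 ≤ √ℓ := Real.one_le_sqrt.2 hℓ
  have hexpn : Real.exp (-(8 * ℓ)) * (n : ℝ) ^ 8 = 1 := by
    have e : (n : ℝ) ^ 8 = Real.exp (8 * ℓ) := by
      have := Real.exp_nat_mul ℓ 8
      rw [hℓdef, Real.exp_log (by linarith)] at this
      rw [← this, hℓdef]
      norm_num
    rw [e, ← Real.exp_add, neg_add_cancel, Real.exp_zero]
  have hend : (∏ l ∈ Finset.range (L + 2), golfRate ℓ l) * (n : ℝ) ^ 8 ≤ 1 := by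
    rw [← hexpn]
    refine mul_le_mul_of_nonneg_right ((prod_golfRate_le_pow hℓ _).trans ?_) (by positivity)
    have hq4 : (1 / 4 : ℝ) ≤ Real.exp (-1) := by
      rw [Real.exp_neg, ← one_div]
      exact one_div_le_one_div_of_le (Real.exp_pos _) (by linarith [Real.exp_one_lt_d9])
    calc (1 / 4 : ℝ) ^ (L + 2) ≤ (1 / 4) ^ L :=
          pow_le_pow_of_le_one (by norm_num) (by norm_num) (by omega)
      _ ≤ Real.exp (-1) ^ L := pow_le_pow_left₀ (by norm_num) hq4 L
      _ = Real.exp (L * (-1)) := (Real.exp_nat_mul _ _).symm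
      _ ≤ Real.exp (-(8 * ℓ)) := Real.exp_le_exp.2 (by linarith)
  have hsn : (T.card : ℝ) ≤ n := by
    exact_mod_cast (Finset.card_le_univ _).trans_eq (Fintype.card_fin n)
  have hμn : μ ≤ n := by nlinarith
  have hp0 := prod_golfRate_nonneg hℓ (L + 2)
  set pr := ∏ l ∈ Finset.range (L + 2), golfRate ℓ l with hpr
  have hdet := measureReal_not_exactRecovery_le hx hf (lam := 1 / √ℓ) (𝕜 := 𝕜)
    (J := J) (κ := golfRate ℓ) (K := L + 2) (t := √(32 * ℓ)) (μ := μ) (a := a)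
    (fun a x f hx0 hf0 hr hs hg => ?_) h1 h2 h3
  · refine hdet.trans ?_
    exact union_bound_le hn0 hsn (Nat.cast_nonneg _) hmn'
      (by push_cast; linarith) (by push_cast; linarith) hε0 (by rw [hε, mul_assoc, hexpn, mul_one])
  · refine exactRecovery_of_goodSample hm hx0 hf0 hr hs hg hJ hJB (fun k => (hκ k).1.le)
      (fun k => (hκ k).2) (Real.sqrt_nonneg _) (by linarith) (by positivity) ?_ hcorr
      (sum_prod_golfRate_le hℓ _) ?_ ?_ ?_
    · rw [div_le_one hsℓ]; exact hsℓ1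
    · intro k hk
      rw [hJc k hk]
      exact golf_entry_le hℓ hL0 hL9 hq1 hTm k
    · exact golf_end_lt hn0 hsn hp0 hend
    · exact golf_end_mul_lt hn0 (by linarith) hsn hmn' hμn (by linarith)
        hℓn hp0 hend

end Main

/-- The outer probability of failure is bounded by `C n⁻³`, so recovery is exact on a measurable
event of probability at least `1 - C n⁻³`. -/
theorem theorem1p2 :
    ∃ C α β : ℝ, 0 < C ∧ 0 < α ∧ 0 < β ∧
      ∀ (𝕜 : Type) [RCLike 𝕜] (m n : ℕ) (μ : ℝ) (ν : Measure (Fin n → 𝕜))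
        (T : Finset (Fin n)) (B : Finset (Fin m))
        (Ω : Type*) [MeasurableSpace Ω] (P : Measure Ω) [IsProbabilityMeasure P]
        (a : Fin m → Ω → Fin n → 𝕜) (x : Ω → Fin n → ℝ) (f : Ω → Fin m → ℝ),
        0 < m → m < n →
        -- the rows are iid copies of the generic sensing vector
        IsSensingLaw ν μ →
        (∀ i, Measurable (a i)) →
        (∀ i, P.map (a i) = ν) →
        iIndepFun a P →
        -- fixed supports, random signs, independent of each other and of the sensing matrix
        HasRandomSigns P T x →
        HasRandomSigns P B f →
        IndepFun (fun ω => signsOn T (x ω)) (fun ω => signsOn B (f ω)) P →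
        IndepFun (fun ω i => a i ω) (fun ω => (signsOn T (x ω), signsOn B (f ω))) P →
        -- sparsity
        (T.card : ℝ) ≤ α * (m / (μ * Real.log n ^ 2)) →
        (B.card : ℝ) ≤ β * (m / μ) →
        P.real {ω | ¬ ExactRecovery (sensingMatrix fun i => a i ω) (1 / √(Real.log n))
            (fun j => (x ω j : 𝕜)) (fun i => (f ω i : 𝕜))} ≤ C * (n : ℝ) ^ (-3 : ℤ) := by
  refine ⟨4000, 1 / 2 ^ 20, 1 / 2048, by norm_num, by norm_num, by norm_num, ?_⟩
  intro 𝕜 _ m n μ ν T B Ω _ P _ a x f hm hmn hν hma hlaw hiid hx hf _ hind hT hB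
  have hn0 : (0 : ℝ) < n := by exact_mod_cast hm.trans hmn
  have hm0 : (0 : ℝ) < m := by exact_mod_cast hm
  rcases Nat.lt_or_ge n 3 with hn | hn
  · -- here `n = 2`, and the constant `C` makes the bound trivial
    have hn2 : n = 2 := by omega
    refine measureReal_le_one.trans ?_
    rw [hn2]
    norm_num
  have hμ : 1 ≤ μ := hν.one_le (by omega)
  have hℓ : 1 ≤ Real.log n := by
    rw [Real.le_log_iff_exp_le hn0]
    have : (3 : ℝ) ≤ n := by exact_mod_cast hn
    linarith [Real.exp_one_lt_d9]
  have ha : Measurable fun ω i => a i ω := measurable_pi_lambda _ hma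
  have hpi : P.map (fun ω i => a i ω) = Measure.pi fun _ => ν := by
    rw [(iIndepFun_iff_map_fun_eq_pi_map fun i => (hma i).aemeasurable).1 hiid]
    simp only [hlaw]
  have hBμ : (B.card : ℝ) * μ ≤ 1 / 2048 * m := by
    rw [← mul_div_assoc, le_div_iff₀ (by linarith)] at hB
    exact hB
  have hsℓ1 : 1 ≤ √(Real.log n) := Real.one_le_sqrt.2 hℓ
  have hcorr : 1 / √(Real.log n) * (√(32 * Real.log n) * √(B.card * μ / m)) ≤ 1 / 8 := by
    have h1 : √(B.card * μ / m) ≤ √(1 / 2048) := by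
      refine Real.sqrt_le_sqrt ?_
      rw [div_le_iff₀ hm0]
      exact hBμ
    have h2 : √32 * √(1 / 2048) = 1 / 8 := by
      rw [← Real.sqrt_mul (by norm_num), Real.sqrt_eq_iff_mul_self_eq (by norm_num) (by norm_num)]
      norm_num
    rw [Real.sqrt_mul (by norm_num)]
    calc 1 / √(Real.log n) * (√32 * √(Real.log n) * √(B.card * μ / m))
        = √32 * √(B.card * μ / m) := by field_simp
      _ ≤ √32 * √(1 / 2048) := by gcongr
      _ = 1 / 8 := h2
  rcases T.eq_empty_or_nonempty with rfl | hTne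
  · have h1 := hν.measureReal_not_exactRecovery_le_of_empty hm hμ ha hpi hx hf hind
      (Real.sqrt_nonneg (32 * Real.log n)) (by positivity)
      (by rw [div_le_one (by linarith)]; exact hsℓ1) hcorr
    refine h1.trans ?_
    rw [Real.sq_sqrt (by linarith)]
    have e : Real.exp (-(32 * Real.log n) / 4) ≤ ((n : ℝ) ^ 4)⁻¹ := by
      rw [← Real.exp_log (show 0 < ((n : ℝ) ^ 4)⁻¹ by positivity), Real.exp_le_exp, Real.log_inv,
        Real.log_pow]
      push_cast
      linarith
    calc (n : ℝ) * (4 * Real.exp (-(32 * Real.log n) / 4)) ≤ n * (4 * ((n : ℝ) ^ 4)⁻¹) := by gcongr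
      _ = 4 * (n : ℝ) ^ (-3 : ℤ) := by
        rw [zpow_neg, zpow_ofNat]
        field_simp
      _ ≤ 4000 * (n : ℝ) ^ (-3 : ℤ) := by gcongr; norm_num
  · refine hν.measureReal_not_exactRecovery_le_of_nonempty hm hmn hn hTne hμ ha hpi hx hf hind hℓ
      ?_ ?_ hcorr
    · rw [← mul_div_assoc, le_div_iff₀ (by positivity)] at hT
      linarith
    · have : (B.card : ℝ) ≤ B.card * μ := le_mul_of_one_le_right (Nat.cast_nonneg _) hμ
      have h2 : (2 * B.card : ℝ) ≤ m := by linarith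
      exact_mod_cast h2
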